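/- Let $\mathcal H$ be a separable complex Hilbert space, $\mathcal B(\mathcal H)$ the algebra of bounded linear operators on $\mathcal H$, and $C$ a conjugation on $\mathcal H$, that is, a conjugate-linear map $C:\mathcal H\to\mathcal H$ with $C^2=I$ and $\langle Cx,Cy\rangle=\langle y,x\rangle$ for all $x,y$. Let $\mathcal O_C=\{X\in\mathcal B(\mathcal H): CXC=-X^*\}$ with the operator norm. For $1\le p<\infty$ let $\mathcal B_p(\mathcal H)$ be the Schatten $p$-class of compact operators $X$ with $\|X\|_p=(\operatorname{tr}|X|^p)^{1/p}<\infty$, and let $\mathcal B_\infty(\mathcal H)$ be the space of compact operators with $\|\cdot\|_\infty$ the operator norm. For $p\in[1,\infty]$ put $\mathcal O_{C,p}=\mathcal O_C\cap\mathcal B_p(\mathcal H)$ with the norm $\|\cdot\|_p$. For $T\in\mathcal O_C$ let $\mathrm{ad}_T(X)=TX-XT$ on $\mathcal O_C$, and let $\mathrm{ad}_{T,p}$ be the restriction of $\mathrm{ad}_T$ to $\mathcal O_{C,p}$, a bounded operator on $(\mathcal O_{C,p},\|\cdot\|_p)$. For a Banach space $\mathcal X$ with dual $\mathcal X'$ and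 a bounded operator $A$ on $\mathcal X$, let $A'$ be the adjoint of $A$ acting on $\mathcal X'$, $A'f=f\circ A$. Bounded operators $A$ on $\mathcal X_1$ and $B$ on $\mathcal X_2$ are similar, $A\sim B$, if there is an invertible bounded linear operator $S:\mathcal X_1\to\mathcal X_2$ with $SA=BS$. Then for every $T\in\mathcal O_C$: (i) $\mathrm{ad}_T\sim-(\mathrm{ad}_{T,1})'$; (ii) $\mathrm{ad}_{T,1}\sim-(\mathrm{ad}_{T,\infty})'$; (iii) $\mathrm{ad}_{T,p}\sim-(\mathrm{ad}_{T,q})'$ for all $p,q\in(1,\infty)$ with $\frac1p+\frac1q=1$. Moreover, in each case the similarity is implemented by the trace duality $Z\mapsto\psi_Z$, $\psi_Z(X)=\operatorname{tr}(XZ)$, which is an isometric isomorphism of $\mathcal O_C$ onto $(\mathcal O_{C,1})'$ in (i), of $\mathcal O_{C,1}$ onto $(\mathcal O_{C,\infty})'$ in (ii), and of $\mathcal O_{C,p}$ onto $(\mathcal O_{C,q})'$ in (iii). -/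

import Mathlib

open scoped ENNReal InnerProductSpace

set_option linter.unusedSectionVars false

namespace SkewLie

section Schatten

universe u
variable {H : Type u} [NormedAddCommGroup H] [InnerProductSpace ℂ H] [CompleteSpace H]

/-- The index set of the fixed orthonormal basis `stdBasis H` of `H`. -/
noncomputable def basisIndex (H : Type*) [NormedAddCommGroup H] [InnerProductSpace ℂ H]
    [CompleteSpace H] : Set H :=
  Classical.choose (exists_hilbertBasis ℂ H)

/-- A fixed orthonormal basis of `H`. -/
noncomputable def stdBasis (H : Type*) [NormedAddCommGroup H] [InnerProductSpace ℂ H]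
    [CompleteSpace H] : HilbertBasis (basisIndex H) ℂ H :=
  Classical.choose (Classical.choose_spec (exists_hilbertBasis ℂ H))

/-- The trace `∑ ⟨e i, A (e i)⟩ ∈ [0, ∞]` of a positive operator `A`; for positive `A` the value
does not depend on the orthonormal basis. It is used for `A = |T| ^ p` only. -/
noncomputable def posTrace (A : H →L[ℂ] H) : ℝ≥0∞ :=
  ∑' i, ENNReal.ofReal (⟪stdBasis H i, A (stdBasis H i)⟫_ℂ).re

theorem tsum_enorm_sq {H : Type*} [NormedAddCommGroup H] [InnerProductSpace ℂ H]
    {ι : Type*} (e : HilbertBasis ι ℂ H) (z : H) :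
    ∑' i, ‖⟪e i, z⟫_ℂ‖ₑ ^ 2 = ‖z‖ₑ ^ 2 := by
  have h := e.hasSum_inner_mul_inner z z
  have h2 : HasSum (fun i => ‖⟪e i, z⟫_ℂ‖ ^ 2) (‖z‖ ^ 2) := by
    have := Complex.hasSum_re h
    convert this using 1
    · ext i
      rw [← inner_conj_symm z (e i), RCLike.conj_mul, ← RCLike.ofReal_pow]
      exact (Complex.ofReal_re _).symm
    · rw [inner_self_eq_norm_sq_to_K]; norm_cast
  have h3 : ∑' i, ENNReal.ofReal (‖⟪e i, z⟫_ℂ‖ ^ 2) = ENNReal.ofReal (‖z‖ ^ 2) := by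
    rw [← h2.tsum_eq, ENNReal.ofReal_tsum_of_nonneg (fun i => by positivity) h2.summable]
  simpa [ENNReal.ofReal_pow] using h3

/-- The trace of a positive diagonalizable operator is the sum of its eigenvalues. -/
theorem posTrace_eq {ι : Type*} (e : HilbertBasis ι ℂ H) (A : H →L[ℂ] H) (l : ι → ℝ)
    (hl : ∀ i, 0 ≤ l i) (hA : ∀ i, A (e i) = (l i : ℂ) • e i) :
    posTrace A = ∑' i, ENNReal.ofReal (l i) := by
  have key : ∀ b : H, ENNReal.ofReal (⟪b, A b⟫_ℂ).re
      = ∑' i, ENNReal.ofReal (l i) * ‖⟪e i, b⟫_ℂ‖ₑ ^ 2 := by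
    intro b
    have h1 : HasSum (fun i => (l i) * ‖⟪e i, b⟫_ℂ‖ ^ 2) (⟪b, A b⟫_ℂ).re := by
      have h := (e.hasSum_repr b).mapL A
      have h := h.mapL (innerSL ℂ b)
      have := Complex.hasSum_re h
      have hf : (fun i => (l i) * ‖⟪e i, b⟫_ℂ‖ ^ 2) = fun i =>
          ((innerSL ℂ b) (A (e.repr b i • e i))).re := by
        funext i
        simp only [map_smul, hA, innerSL_apply_apply, e.repr_apply_apply, smul_eq_mul]
        rw [← inner_conj_symm b (e i), mul_left_comm, RCLike.mul_conj, ← RCLike.ofReal_pow]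
        rw [Complex.re_ofReal_mul]
        congr 1
      rw [hf]
      exact this
    rw [← h1.tsum_eq, ENNReal.ofReal_tsum_of_nonneg
      (fun i => mul_nonneg (hl i) (by positivity)) h1.summable]
    refine tsum_congr fun i => ?_
    rw [ENNReal.ofReal_mul (hl i), ENNReal.ofReal_pow (norm_nonneg _), ofReal_norm]
  unfold posTrace
  simp_rw [key]
  rw [ENNReal.tsum_comm]
  refine tsum_congr fun i => ?_
  rw [ENNReal.tsum_mul_left]
  have h := tsum_enorm_sq (stdBasis H) (e i)
  have h2 : ∀ j, ‖⟪e i, stdBasis H j⟫_ℂ‖ₑ = ‖⟪stdBasis H j, e i⟫_ℂ‖ₑ := fun j => by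
    rw [← ofReal_norm, ← ofReal_norm, norm_inner_symm]
  simp_rw [h2, h]
  have : ‖e i‖ = 1 := e.orthonormal.1 i
  rw [← ofReal_norm, this]; simp

/-- The continuous functional calculus acts on eigenvectors through the eigenvalues. -/
theorem cfc_apply_eigenvector (A : H →L[ℂ] H) (hA : IsSelfAdjoint A) (f : ℝ → ℝ)
    (hf : Continuous f) (x : H) (l : ℝ) (hx : A x = (l : ℂ) • x) :
    cfc f A x = (f l : ℂ) • x := by
  by_cases hx0 : x = 0
  · simp [hx0]
  have hl : l ∈ spectrum ℝ A := by
    intro h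
    obtain ⟨u, hu⟩ := h
    have h1 : (u : H →L[ℂ] H) x = 0 := by
      rw [hu]
      simp [hx, Algebra.algebraMap_eq_smul_one]
    apply hx0
    have h2 : ((u⁻¹ : (H →L[ℂ] H)ˣ) : H →L[ℂ] H) ((u : H →L[ℂ] H) x) = x := by
      rw [← mul_apply_eq_comp, Units.inv_mul]; rfl
    rw [← h2, h1, map_zero]
  have hcomp : CompactSpace (spectrum ℝ A) := inferInstance
  have main : ∀ g : C(spectrum ℝ A, ℝ), cfcHom hA g x = ((g ⟨l, hl⟩ : ℝ) : ℂ) • x := by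
    intro g
    have hid : cfcHom hA (.restrict (spectrum ℝ A) <| .id ℝ) x = (l : ℂ) • x := by
      rw [cfcHom_id hA]; exact hx
    refine ContinuousMap.induction_on_of_compact (p := fun g : C(spectrum ℝ A, ℝ) =>
      cfcHom hA g x = ((g ⟨l, hl⟩ : ℝ) : ℂ) • x) ?_ hid ?_ ?_ ?_ ?_ g
    · intro r
      have := AlgHomClass.commutes (cfcHom hA) r
      rw [show ContinuousMap.const (spectrum ℝ A) r = algebraMap ℝ _ r from rfl, this]
      rw [IsScalarTower.algebraMap_apply ℝ ℂ (H →L[ℂ] H), Algebra.algebraMap_eq_smul_one]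
      rfl
    · rw [star_trivial]; exact hid
    · intro f g hf hg
      simp [map_add, hf, hg, add_smul]
    · intro f g hf hg
      rw [map_mul, mul_apply_eq_comp, hg, map_smul, hf, smul_smul, ContinuousMap.mul_apply,
        Complex.ofReal_mul, mul_comm]
    · intro f hfr
      have hcl : IsClosed {g : C(spectrum ℝ A, ℝ) |
          cfcHom hA g x = ((g ⟨l, hl⟩ : ℝ) : ℂ) • x} := by
        refine isClosed_eq ?_ ?_
        · exact (ContinuousLinearMap.apply ℂ H x).continuous.comp (cfcHom_continuous hA)
        · exact (Complex.continuous_ofReal.comp (continuous_eval_const _)).smul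
            continuous_const
      exact hcl.closure_subset (mem_closure_iff_frequently.2 hfr)
  rw [cfc_apply f A hA hf.continuousOn, main]
  rfl

/-- A compact self-adjoint operator has an orthonormal basis of eigenvectors. -/
theorem exists_eigenbasis (A : H →L[ℂ] H) (hA : IsSelfAdjoint A) (hc : IsCompactOperator A) :
    ∃ (ι : Type u) (e : HilbertBasis ι ℂ H) (l : ι → ℂ), ∀ i, A (e i) = l i • e i := by
  have hs : (A : H →ₗ[ℂ] H).IsSymmetric := hA.isSymmetric
  have hbot := ContinuousLinearMap.orthogonalComplement_iSup_eigenspaces_eq_bot hc hs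
  let V : ℂ → Submodule ℂ H := fun μ => Module.End.eigenspace (A : Module.End ℂ H) μ
  have hclosed : ∀ μ, IsClosed (V μ : Set H) := fun μ => by
    have : (V μ : Set H) = {x | A x = μ • x} := by
      ext x; simp [V]
    rw [this]
    exact isClosed_eq A.continuous (continuous_const_smul μ)
  have hcs : ∀ μ, CompleteSpace (V μ) := fun μ => (hclosed μ).completeSpace_coe
  choose w b hb using fun μ => exists_hilbertBasis ℂ (V μ)
  let v : (Σ μ, w μ) → H := fun s => (b s.1 s.2 : H)
  have hv : Orthonormal ℂ v :=
    hs.orthogonalFamily_eigenspaces.orthonormal_sigma_orthonormal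
      (v_family := fun μ => b μ) (fun μ => (b μ).orthonormal)
  have hsp : (Submodule.span ℂ (Set.range v))ᗮ = ⊥ := by
    rw [eq_bot_iff, ← hbot]
    intro x hx
    rw [← Submodule.iInf_orthogonal, Submodule.mem_iInf]
    intro μ y hy
    have h := ((b μ).hasSum_repr ⟨y, hy⟩).mapL (V μ).subtypeL
    have h := h.mapL (innerSL ℂ x)
    have h0 : ∀ i, innerSL ℂ x ((V μ).subtypeL ((b μ).repr ⟨y, hy⟩ i • b μ i)) = 0 := by
      intro i
      have : ⟪v ⟨μ, i⟩, x⟫_ℂ = 0 := hx _ (Submodule.subset_span ⟨⟨μ, i⟩, rfl⟩)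
      rw [inner_eq_zero_symm] at this
      simp only [map_smul, innerSL_apply_apply, smul_eq_mul]
      exact mul_eq_zero_of_right _ this
    simp_rw [h0] at h
    have := h.unique hasSum_zero
    rw [inner_eq_zero_symm]
    exact this
  refine ⟨_, HilbertBasis.mkOfOrthogonalEqBot hv hsp, fun s => s.1, fun s => ?_⟩
  rw [HilbertBasis.coe_mkOfOrthogonalEqBot]
  have := (b s.1 s.2).2
  exact Module.End.mem_eigenspace_iff.1 this

/-- Families satisfying the Bessel inequality with constant `1`. -/
def Bessel {H : Type*} [NormedAddCommGroup H] [InnerProductSpace ℂ H] {ι : Type*} (y : ι → H) :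
    Prop :=
  ∀ z : H, ∑' i, ‖⟪y i, z⟫_ℂ‖ₑ ^ 2 ≤ ‖z‖ₑ ^ 2

theorem Bessel.enorm_sq_le {H : Type*} [NormedAddCommGroup H] [InnerProductSpace ℂ H]
    {ι : Type*} {y : ι → H} (hy : Bessel y) (i : ι) : ‖y i‖ₑ ^ 2 ≤ 1 := by
  have h := (ENNReal.le_tsum (f := fun j => ‖⟪y j, y i⟫_ℂ‖ₑ ^ 2) i).trans (hy (y i))
  have h1 : ‖⟪y i, y i⟫_ℂ‖ = ‖y i‖ ^ 2 := by
    rw [inner_self_eq_norm_sq_to_K]; simp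
  have h2 : ‖⟪y i, y i⟫_ℂ‖ₑ = ‖y i‖ₑ ^ 2 := by
    rw [← ofReal_norm, h1, ENNReal.ofReal_pow (norm_nonneg _), ofReal_norm]
  simp only [h2] at h
  by_contra hlt
  push Not at hlt
  have h3 : ‖y i‖ₑ ^ 2 ≠ ⊤ := by simp
  have h4 : ‖y i‖ₑ ^ 2 * 1 < ‖y i‖ₑ ^ 2 * ‖y i‖ₑ ^ 2 := by
    refine (ENNReal.mul_lt_mul_iff_right ?_ h3).2 hlt
    exact (zero_lt_one.trans hlt).ne'
  rw [mul_one, ← sq] at h4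
  exact absurd h (not_le.2 h4)

theorem Bessel.comp {ι : Type*} {y : ι → H} (hy : Bessel y) (B : H →L[ℂ] H) (hB : ‖B‖ ≤ 1) :
    Bessel fun i => B (y i) := by
  intro z
  have h1 : ∀ i, ⟪B (y i), z⟫_ℂ = ⟪y i, ContinuousLinearMap.adjoint B z⟫_ℂ := fun i =>
    (ContinuousLinearMap.adjoint_inner_right B (y i) z).symm
  simp_rw [h1]
  refine (hy _).trans ?_
  gcongr
  rw [← ofReal_norm, ← ofReal_norm]
  apply ENNReal.ofReal_le_ofReal
  calc ‖ContinuousLinearMap.adjoint B z‖ ≤ ‖ContinuousLinearMap.adjoint B‖ * ‖z‖ :=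
        ContinuousLinearMap.le_opNorm _ _
    _ = ‖B‖ * ‖z‖ := by rw [LinearIsometryEquiv.norm_map]
    _ ≤ ‖z‖ := mul_le_of_le_one_left (norm_nonneg _) hB

theorem Bessel.basis {H : Type*} [NormedAddCommGroup H] [InnerProductSpace ℂ H]
    {ι : Type*} (e : HilbertBasis ι ℂ H) : Bessel e :=
  fun z => (tsum_enorm_sq e z).le

/-- Schmidt decomposition of a compact operator. -/
theorem exists_schmidt (T : H →L[ℂ] H) (hT : IsCompactOperator T) :
    ∃ (ι : Type u) (x : HilbertBasis ι ℂ H) (y : ι → H) (m : ι → ℝ), Bessel y ∧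
      (∀ i, 0 ≤ m i) ∧ (∀ i, T (x i) = (m i : ℂ) • y i) ∧ (∀ i, ⟪y i, T (x i)⟫_ℂ = m i) ∧
      ∀ r : ℝ, 1 ≤ r → posTrace (CFC.abs T ^ r) = ∑' i, ENNReal.ofReal (m i ^ r) := by
  have hsa : IsSelfAdjoint (star T * T) := IsSelfAdjoint.star_mul_self T
  have hcomp : IsCompactOperator (star T * T) := hT.clm_comp (star T)
  obtain ⟨ι, x, l, hl⟩ := exists_eigenbasis (star T * T) hsa hcomp
  have hnorm : ∀ i, ‖x i‖ = 1 := x.orthonormal.1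
  have hin : ∀ i j, ⟪T (x i), T (x j)⟫_ℂ = l j * ⟪x i, x j⟫_ℂ := fun i j => by
    rw [← ContinuousLinearMap.adjoint_inner_right T, ← inner_smul_right, ← hl j]
    rfl
  let m : ι → ℝ := fun i => ‖T (x i)‖
  have hlm : ∀ i, l i = ((m i ^ 2 : ℝ) : ℂ) := fun i => by
    have h := hin i i
    rw [inner_self_eq_norm_sq_to_K, inner_self_eq_norm_sq_to_K, hnorm i] at h
    simp only [m]
    rw [Complex.ofReal_pow]
    simpa using h.symm
  let y : ι → H := fun i => ((m i)⁻¹ : ℂ) • T (x i)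
  have hTx : ∀ i, T (x i) = (m i : ℂ) • y i := fun i => by
    by_cases h : m i = 0
    · have : T (x i) = 0 := norm_eq_zero.1 h
      simp [this, h]
    · have h' : (m i : ℂ) ≠ 0 := by exact_mod_cast h
      simp only [y]
      rw [smul_smul, mul_inv_cancel₀ h', one_smul]
  have hyT : ∀ i, ⟪y i, T (x i)⟫_ℂ = m i := fun i => by
    by_cases h : m i = 0
    · have : T (x i) = 0 := norm_eq_zero.1 h
      simp [this, h]
    · have h' : (m i : ℂ) ≠ 0 := by exact_mod_cast h
      simp only [y]
      rw [inner_smul_left, hin, hlm, inner_self_eq_norm_sq_to_K, hnorm]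
      simp
      field_simp
  have hort : Orthonormal ℂ (fun i : {i // m i ≠ 0} => y i) := by
    constructor
    · rintro ⟨i, hi⟩
      simp only [y, norm_smul]
      rw [norm_inv, Complex.norm_real, Real.norm_of_nonneg (norm_nonneg _)]
      exact inv_mul_cancel₀ hi
    · rintro ⟨i, hi⟩ ⟨j, hj⟩ hij
      have hij' : i ≠ j := fun h => hij (Subtype.ext h)
      simp only [y]
      rw [inner_smul_left, inner_smul_right, hin, x.orthonormal.2 hij']
      simp
  refine ⟨ι, x, y, m, ?_, fun i => norm_nonneg _, hTx, hyT, ?_⟩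
  · intro z
    have hsupp : Function.support (fun i => ‖⟪y i, z⟫_ℂ‖ₑ ^ 2) ⊆ {i | m i ≠ 0} := by
      intro i hi hm
      apply hi
      simp [y, hm]
    rw [← tsum_subtype_eq_of_support_subset hsupp]
    have h1 := hort.tsum_inner_products_le z
    have h2 := ENNReal.ofReal_le_ofReal h1
    rw [ENNReal.ofReal_tsum_of_nonneg (fun i => by positivity) (hort.inner_products_summable z)]
      at h2
    simp only [ENNReal.ofReal_pow (norm_nonneg _), ofReal_norm] at h2
    exact h2
  · intro r hr
    refine posTrace_eq x _ (fun i => m i ^ r) (fun i => Real.rpow_nonneg (norm_nonneg _) _) ?_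
    intro i
    have hpos : 0 ≤ star T * T := star_mul_self_nonneg T
    have h1 : CFC.abs T ^ r = (star T * T) ^ (r / 2) := by
      lift r to NNReal using by linarith
      exact CFC.rpow_sqrt_nnreal
    rw [h1, CFC.rpow_eq_cfc_real]
    rw [cfc_apply_eigenvector _ hsa _ (Real.continuous_rpow_const (by linarith)) _ (m i ^ 2)
      (by rw [hl, hlm])]
    congr 2
    rw [← Real.rpow_natCast, ← Real.rpow_mul (norm_nonneg _)]
    congr 1
    push_cast
    ring

theorem two_mul_le (a b : ℝ≥0∞) (ha : a ≠ ⊤) (hb : b ≠ ⊤) : 2 * (a * b) ≤ a ^ 2 + b ^ 2 := by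
  lift a to NNReal using ha
  lift b to NNReal using hb
  norm_cast
  rw [← NNReal.coe_le_coe]
  push_cast
  nlinarith [sq_nonneg ((a : ℝ) - b)]

theorem jensen {κ : Type*} (w m : κ → ℝ≥0∞) (hw : ∑' j, w j ≤ 1) (p : ℝ) (hp : 1 ≤ p) :
    (∑' j, w j * m j) ^ p ≤ ∑' j, w j * m j ^ p := by
  have hp0 : 0 < p := by linarith
  rw [← ENNReal.le_rpow_inv_iff hp0]
  rw [ENNReal.tsum_eq_iSup_sum]
  refine iSup_le fun s => ?_
  refine (ENNReal.inner_le_weight_mul_Lp_of_nonneg s hp w m).trans ?_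
  have h1 : (∑ i ∈ s, w i) ^ (1 - p⁻¹) ≤ 1 := by
    refine ENNReal.rpow_le_one ((ENNReal.sum_le_tsum s).trans hw) ?_
    rw [sub_nonneg]
    exact inv_le_one_of_one_le₀ hp
  calc _ ≤ 1 * (∑ i ∈ s, w i * m i ^ p) ^ p⁻¹ := by gcongr
    _ ≤ _ := by
      rw [one_mul]
      gcongr
      exact ENNReal.sum_le_tsum s

theorem sum_le_posTrace (T : H →L[ℂ] H) (hT : IsCompactOperator T) (p : ℝ) (hp : 1 ≤ p)
    {κ : Type*} (e f : κ → H) (he : Bessel e) (hf : Bessel f) :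
    ∑' k, ‖⟪f k, T (e k)⟫_ℂ‖ₑ ^ p ≤ posTrace (CFC.abs T ^ p) := by
  obtain ⟨ι, x, y, m, hy, hm, hTx, -, htr⟩ := exists_schmidt T hT
  rw [htr p hp]
  let w : κ → ι → ℝ≥0∞ := fun k j => (‖⟪x j, e k⟫_ℂ‖ₑ ^ 2 + ‖⟪y j, f k⟫_ℂ‖ₑ ^ 2) / 2
  let M : ι → ℝ≥0∞ := fun j => ENNReal.ofReal (m j)
  have hrow : ∀ k, ∑' j, w k j ≤ 1 := fun k => by
    simp only [w, ENNReal.div_eq_inv_mul]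
    rw [ENNReal.tsum_mul_left, ENNReal.tsum_add]
    calc _ ≤ 2⁻¹ * ((1 : ℝ≥0∞) + 1) := by
          gcongr
          · exact (Bessel.basis x _).trans (he.enorm_sq_le k)
          · exact (hy _).trans (hf.enorm_sq_le k)
      _ = 1 := by
        rw [one_add_one_eq_two]; exact ENNReal.inv_mul_cancel (by simp) (by simp)
  have hsymm : ∀ a b : H, ‖⟪a, b⟫_ℂ‖ₑ = ‖⟪b, a⟫_ℂ‖ₑ := fun a b => by
    rw [← ofReal_norm, ← ofReal_norm, norm_inner_symm]
  have hcol : ∀ j, ∑' k, w k j ≤ 1 := fun j => by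
    simp only [w, ENNReal.div_eq_inv_mul]
    rw [ENNReal.tsum_mul_left, ENNReal.tsum_add]
    simp_rw [hsymm (x j), hsymm (y j)]
    calc _ ≤ 2⁻¹ * ((1 : ℝ≥0∞) + 1) := by
          gcongr
          · exact (he _).trans ((Bessel.basis x).enorm_sq_le j)
          · exact (hf _).trans (hy.enorm_sq_le j)
      _ = 1 := by
        rw [one_add_one_eq_two]; exact ENNReal.inv_mul_cancel (by simp) (by simp)
  have hterm : ∀ k, ‖⟪f k, T (e k)⟫_ℂ‖ₑ ≤ ∑' j, w k j * M j := fun k => by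
    have h := ((x.hasSum_repr (e k)).mapL T).mapL (innerSL ℂ (f k))
    have h2 : ⟪f k, T (e k)⟫_ℂ = ∑' j, (innerSL ℂ (f k)) (T (x.repr (e k) j • x j)) :=
      h.tsum_eq.symm
    rw [h2]
    refine enorm_tsum_le_tsum_enorm.trans (ENNReal.tsum_le_tsum fun j => ?_)
    simp only [map_smul, hTx, innerSL_apply_apply, x.repr_apply_apply, smul_eq_mul, enorm_mul]
    rw [hsymm (f k) (y j)]
    have h3 : ‖(m j : ℂ)‖ₑ = M j := by
      rw [← ofReal_norm, Complex.norm_real, Real.norm_of_nonneg (hm j)]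
    rw [h3]
    calc ‖⟪x j, e k⟫_ℂ‖ₑ * (M j * ‖⟪y j, f k⟫_ℂ‖ₑ)
        = (‖⟪x j, e k⟫_ℂ‖ₑ * ‖⟪y j, f k⟫_ℂ‖ₑ) * M j := by ring
      _ ≤ w k j * M j := by
        gcongr
        simp only [w]
        rw [ENNReal.le_div_iff_mul_le (by simp) (by simp), mul_comm]
        exact two_mul_le _ _ (by simp) (by simp)
  calc ∑' k, ‖⟪f k, T (e k)⟫_ℂ‖ₑ ^ p ≤ ∑' k, ∑' j, w k j * M j ^ p := by
        refine ENNReal.tsum_le_tsum fun k => ?_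
        refine le_trans ?_ (jensen (w k) M (hrow k) p hp)
        gcongr
        exact hterm k
    _ = ∑' j, (∑' k, w k j) * M j ^ p := by
        rw [ENNReal.tsum_comm]
        refine tsum_congr fun j => ?_
        rw [ENNReal.tsum_mul_right]
    _ ≤ ∑' j, ENNReal.ofReal (m j ^ p) := by
        refine ENNReal.tsum_le_tsum fun j => ?_
        rw [← ENNReal.ofReal_rpow_of_nonneg (hm j) (by linarith)]
        exact mul_le_of_le_one_left zero_le (hcol j)

theorem minkowski {κ : Type*} (a b : κ → ℝ≥0∞) (p : ℝ) (hp : 1 ≤ p) :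
    (∑' k, (a k + b k) ^ p) ^ (1 / p) ≤ (∑' k, a k ^ p) ^ (1 / p) + (∑' k, b k ^ p) ^ (1 / p) := by
  have hp0 : 0 < p := by linarith
  rw [one_div, ENNReal.rpow_inv_le_iff hp0, ENNReal.tsum_eq_iSup_sum]
  refine iSup_le fun s => ?_
  rw [← ENNReal.rpow_inv_le_iff hp0, ← one_div]
  refine (ENNReal.Lp_add_le s a b hp).trans ?_
  gcongr
  · exact ENNReal.sum_le_tsum s
  · exact ENNReal.sum_le_tsum s

theorem exists_posTrace_eq (T : H →L[ℂ] H) (hT : IsCompactOperator T) :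
    ∃ (ι : Type u) (x y : ι → H), Bessel x ∧ Bessel y ∧
      ∀ r : ℝ, 1 ≤ r → posTrace (CFC.abs T ^ r) = ∑' i, ‖⟪y i, T (x i)⟫_ℂ‖ₑ ^ r := by
  obtain ⟨ι, x, y, m, hy, hm, -, hyT, htr⟩ := exists_schmidt T hT
  refine ⟨ι, x, y, Bessel.basis x, hy, fun r hr => ?_⟩
  rw [htr r hr]
  refine tsum_congr fun i => ?_
  rw [hyT, ← ENNReal.ofReal_rpow_of_nonneg (hm i) (by linarith), ← ofReal_norm, Complex.norm_real,
    Real.norm_of_nonneg (hm i)]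

/-- The Schatten norm `‖T‖_p = (tr |T| ^ p) ^ (1 / p)` for `p < ∞`, where `|T| = (T* T) ^ (1 / 2)`,
and `‖T‖_∞ = ‖T‖`, with values in `[0, ∞]`. -/
noncomputable def schattenENorm (p : ℝ≥0∞) (T : H →L[ℂ] H) : ℝ≥0∞ :=
  if p = ∞ then ‖T‖ₑ else posTrace (CFC.abs T ^ p.toReal) ^ (1 / p.toReal)

/-- Membership in the Schatten class `B_p(H)`: compact operators with `‖T‖_p < ∞`.
In particular `B_∞(H)` is the set of all compact operators. -/
def IsSchatten (p : ℝ≥0∞) (T : H →L[ℂ] H) : Prop :=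
  IsCompactOperator T ∧ schattenENorm p T < ∞

theorem one_le_toReal {p : ℝ≥0∞} (hp : 1 ≤ p) (h : p ≠ ∞) : 1 ≤ p.toReal := by
  simpa using ENNReal.toReal_mono h hp

theorem schattenENorm_add_le {p : ℝ≥0∞} (hp : 1 ≤ p) {S T : H →L[ℂ] H}
    (hS : IsCompactOperator S) (hT : IsCompactOperator T) :
    schattenENorm p (S + T) ≤ schattenENorm p S + schattenENorm p T := by
  unfold schattenENorm
  split_ifs with h
  · exact enorm_add_le _ _
  have hp' := one_le_toReal hp h
  obtain ⟨ι, x, y, hx, hy, htr⟩ := exists_posTrace_eq (S + T) (hS.add hT)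
  rw [htr _ hp']
  calc _ ≤ (∑' k, (‖⟪y k, S (x k)⟫_ℂ‖ₑ + ‖⟪y k, T (x k)⟫_ℂ‖ₑ) ^ p.toReal) ^ (1 / p.toReal) := by
        gcongr with k
        rw [add_apply, inner_add_right]
        exact enorm_add_le _ _
    _ ≤ _ := minkowski _ _ _ hp'
    _ ≤ _ := by
        gcongr
        · exact sum_le_posTrace S hS _ hp' x y hx hy
        · exact sum_le_posTrace T hT _ hp' x y hx hy

theorem schattenENorm_smul_le {p : ℝ≥0∞} (hp : 1 ≤ p) {T : H →L[ℂ] H}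
    (hT : IsCompactOperator T) (c : ℂ) :
    schattenENorm p (c • T) ≤ ‖c‖ₑ * schattenENorm p T := by
  unfold schattenENorm
  split_ifs with h
  · exact (enorm_smul c T).le
  have hp' := one_le_toReal hp h
  have hp0 : 0 < p.toReal := by linarith
  obtain ⟨ι, x, y, hx, hy, htr⟩ := exists_posTrace_eq (c • T) (hT.smul c)
  rw [htr _ hp']
  simp only [smul_apply, inner_smul_right, enorm_mul,
    ENNReal.mul_rpow_of_nonneg _ _ hp0.le]
  rw [ENNReal.tsum_mul_left, ENNReal.mul_rpow_of_nonneg _ _ (by positivity), ← ENNReal.rpow_mul,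
    mul_one_div_cancel hp0.ne', ENNReal.rpow_one]
  gcongr
  exact sum_le_posTrace T hT _ hp' x y hx hy

theorem schattenENorm_smul {p : ℝ≥0∞} (hp : 1 ≤ p) {T : H →L[ℂ] H}
    (hT : IsCompactOperator T) (c : ℂ) :
    schattenENorm p (c • T) = ‖c‖ₑ * schattenENorm p T := by
  refine le_antisymm (schattenENorm_smul_le hp hT c) ?_
  by_cases hc : c = 0
  · simp [hc]
  have h0 : ‖c‖ₑ ≠ 0 := by simpa using hc
  have h2 : c⁻¹ • c • T = T := by rw [smul_smul, inv_mul_cancel₀ hc, one_smul]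
  have h := schattenENorm_smul_le (T := c • T) hp (hT.smul c) c⁻¹
  rw [h2, enorm_inv hc] at h
  calc ‖c‖ₑ * schattenENorm p T ≤ ‖c‖ₑ * (‖c‖ₑ⁻¹ * schattenENorm p (c • T)) := by gcongr
    _ = schattenENorm p (c • T) := by
      rw [← mul_assoc, ENNReal.mul_inv_cancel h0 enorm_ne_top, one_mul]

theorem eq_zero_of_schattenENorm {p : ℝ≥0∞} (hp : 1 ≤ p) {T : H →L[ℂ] H}
    (hT : IsCompactOperator T) (h0 : schattenENorm p T = 0) : T = 0 := by
  unfold schattenENorm at h0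
  split_ifs at h0 with h
  · simpa using h0
  have hp' := one_le_toReal hp h
  have hp0 : 0 < p.toReal := by linarith
  obtain ⟨ι, x, y, m, hy, hm, hTx, -, htr⟩ := exists_schmidt T hT
  rw [htr _ hp', ENNReal.rpow_eq_zero_iff_of_pos (by positivity), ENNReal.tsum_eq_zero] at h0
  ext z
  have hz := (x.hasSum_repr z).mapL T
  have hm0 : ∀ i, m i = 0 := fun i => by
    have h1 := h0 i
    rw [ENNReal.ofReal_eq_zero] at h1
    exact (Real.rpow_eq_zero (hm i) hp0.ne').1 (le_antisymm h1 (Real.rpow_nonneg (hm i) _))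
  simp only [map_smul, hTx, hm0, Complex.ofReal_zero, zero_smul, smul_zero] at hz
  exact hz.unique hasSum_zero

theorem schattenENorm_mul_aux {p : ℝ≥0∞} (hp : 1 ≤ p) {T : H →L[ℂ] H}
    (hT : IsCompactOperator T) (A B : H →L[ℂ] H) (hA : ‖A‖ ≤ 1) (hB : ‖B‖ ≤ 1) :
    schattenENorm p (A * T * B) ≤ schattenENorm p T := by
  unfold schattenENorm
  split_ifs with h
  · rw [← ofReal_norm, ← ofReal_norm]
    apply ENNReal.ofReal_le_ofReal
    calc ‖A * T * B‖ ≤ ‖A‖ * ‖T‖ * ‖B‖ := (norm_mul_le _ _).trans (by gcongr; exact norm_mul_le _ _)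
      _ ≤ 1 * ‖T‖ * 1 := by gcongr
      _ = ‖T‖ := by ring
  have hp' := one_le_toReal hp h
  have hc : IsCompactOperator (A * T * B) := (hT.clm_comp A).comp_clm B
  obtain ⟨ι, x, y, hx, hy, htr⟩ := exists_posTrace_eq (A * T * B) hc
  rw [htr _ hp']
  gcongr
  have h1 : ∀ i, ⟪y i, (A * T * B) (x i)⟫_ℂ = ⟪ContinuousLinearMap.adjoint A (y i), T (B (x i))⟫_ℂ :=
    fun i => (ContinuousLinearMap.adjoint_inner_left A _ _).symm
  simp_rw [h1]
  refine sum_le_posTrace T hT _ hp' _ _ (hx.comp B hB) (hy.comp _ ?_)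
  rwa [LinearIsometryEquiv.norm_map]

theorem schattenENorm_mul {p : ℝ≥0∞} (hp : 1 ≤ p) {T : H →L[ℂ] H}
    (hT : IsCompactOperator T) (A B : H →L[ℂ] H) :
    schattenENorm p (A * T * B) ≤ ‖A‖ₑ * schattenENorm p T * ‖B‖ₑ := by
  have hzero : schattenENorm p (0 : H →L[ℂ] H) = 0 := by
    have := schattenENorm_smul hp hT 0
    simpa using this
  by_cases hA : A = 0
  · simp [hA, hzero]
  by_cases hB : B = 0
  · simp [hB, hzero]
  have hA' : ‖A‖ ≠ 0 := norm_ne_zero_iff.2 hA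
  have hB' : ‖B‖ ≠ 0 := norm_ne_zero_iff.2 hB
  let A₁ : H →L[ℂ] H := ((‖A‖⁻¹ : ℝ) : ℂ) • A
  let B₁ : H →L[ℂ] H := ((‖B‖⁻¹ : ℝ) : ℂ) • B
  have hA₁ : ‖A₁‖ ≤ 1 := by
    simp only [A₁, norm_smul, Complex.norm_real, norm_inv, norm_norm]
    exact (inv_mul_cancel₀ hA').le
  have hB₁ : ‖B₁‖ ≤ 1 := by
    simp only [B₁, norm_smul, Complex.norm_real, norm_inv, norm_norm]
    exact (inv_mul_cancel₀ hB').le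
  have hc : IsCompactOperator (A₁ * T * B₁) := (hT.clm_comp A₁).comp_clm B₁
  have hcA : (‖A‖ : ℂ) ≠ 0 := by exact_mod_cast hA'
  have hcB : (‖B‖ : ℂ) ≠ 0 := by exact_mod_cast hB'
  have h1 : A * T * B = ((‖A‖ * ‖B‖ : ℝ) : ℂ) • (A₁ * T * B₁) := by
    simp only [A₁, B₁, smul_mul_assoc, mul_smul_comm, smul_smul]
    push_cast
    rw [show (‖A‖ * ‖B‖ * ((‖B‖ : ℂ)⁻¹ * (‖A‖ : ℂ)⁻¹) : ℂ) = 1 by field_simp, one_smul]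
  rw [h1, schattenENorm_smul hp hc]
  have h2 : ‖((‖A‖ * ‖B‖ : ℝ) : ℂ)‖ₑ = ‖A‖ₑ * ‖B‖ₑ := by
    rw [Complex.ofReal_mul, enorm_mul, ← ofReal_norm, ← ofReal_norm, Complex.norm_real,
      Complex.norm_real, norm_norm, norm_norm, ofReal_norm, ofReal_norm]
  rw [h2]
  calc _ ≤ ‖A‖ₑ * ‖B‖ₑ * schattenENorm p T := by
        gcongr
        exact schattenENorm_mul_aux hp hT _ _ hA₁ hB₁
    _ = _ := by ring

end Schatten

/-- A conjugation: a conjugate-linear involution `C` with `⟨C x, C y⟩ = ⟨y, x⟩`. -/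
structure Conjugation (H : Type*) [NormedAddCommGroup H] [InnerProductSpace ℂ H] where
  toFun : H → H
  map_add' : ∀ x y, toFun (x + y) = toFun x + toFun y
  map_smul' : ∀ (c : ℂ) (x : H), toFun (c • x) = (starRingEnd ℂ) c • toFun x
  involutive' : ∀ x, toFun (toFun x) = x
  inner_map_map' : ∀ x y, ⟪toFun x, toFun y⟫_ℂ = ⟪y, x⟫_ℂ

section Skew

variable {H : Type*} [NormedAddCommGroup H] [InnerProductSpace ℂ H] [CompleteSpace H]

/-- `O_C = {X ∈ B(H) : C X C = - X*}`, normed by the operator norm. -/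
def skew (C : Conjugation H) : Submodule ℂ (H →L[ℂ] H) where
  carrier := {X | ∀ x, C.toFun (X (C.toFun x)) = -(ContinuousLinearMap.adjoint X x)}
  zero_mem' := fun x => by
    have h := C.map_smul' 0 0
    simp only [zero_smul, map_zero] at h
    simp [h]
  add_mem' := fun {X Y} hX hY x => by
    rw [add_apply, C.map_add', hX x, hY x, map_add,
      add_apply, neg_add]
  smul_mem' := fun c X hX x => by
    rw [smul_apply, C.map_smul', hX x, map_smulₛₗ,
      smul_apply, smul_neg]

theorem lie_mem_skew (C : Conjugation H) {T X : H →L[ℂ] H} (hT : T ∈ skew C) (hX : X ∈ skew C) :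
    T * X - X * T ∈ skew C := by
  have hneg : ∀ x, C.toFun (-x) = -C.toFun x := fun x => by
    simpa using C.map_smul' (-1) x
  have hprod : ∀ {T X : H →L[ℂ] H}, T ∈ skew C → X ∈ skew C → ∀ x,
      C.toFun (T (X (C.toFun x))) =
        ContinuousLinearMap.adjoint T (ContinuousLinearMap.adjoint X x) := by
    intro T X hT hX x
    have h1 := hT (C.toFun (X (C.toFun x)))
    rw [C.involutive', hX x, map_neg, neg_neg] at h1
    exact h1
  intro x
  rw [sub_apply, sub_eq_add_neg, C.map_add', hneg]
  simp only [mul_apply_eq_comp]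
  rw [hprod hT hX, hprod hX hT]
  have hstar : ContinuousLinearMap.adjoint (T * X - X * T) =
      ContinuousLinearMap.adjoint X * ContinuousLinearMap.adjoint T -
      ContinuousLinearMap.adjoint T * ContinuousLinearMap.adjoint X := by
    simp only [← ContinuousLinearMap.star_eq_adjoint, star_sub, star_mul]
  rw [hstar, sub_apply]
  simp only [mul_apply_eq_comp]
  abel

/-- `ad_T : O_C → O_C`, `X ↦ [T, X] = T X - X T`, as a bounded operator for the operator norm. -/
noncomputable def ad (C : Conjugation H) (T : skew C) : skew C →L[ℂ] skew C :=
  LinearMap.mkContinuous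
    { toFun := fun X => ⟨T * X - X * T, lie_mem_skew C T.2 X.2⟩
      map_add' := fun X Y => by
        ext1; simp only [Submodule.coe_add, mul_add, add_mul]; abel
      map_smul' := fun c X => by
        ext1; simp [smul_sub] }
    (2 * ‖T‖) fun X => by
      change ‖(T : H →L[ℂ] H) * X - X * T‖ ≤ 2 * ‖(T : H →L[ℂ] H)‖ * ‖(X : H →L[ℂ] H)‖
      calc _ ≤ ‖(T : H →L[ℂ] H) * X‖ + ‖(X : H →L[ℂ] H) * T‖ := norm_sub_le _ _
        _ ≤ ‖(T : H →L[ℂ] H)‖ * ‖(X : H →L[ℂ] H)‖ + ‖(X : H →L[ℂ] H)‖ * ‖(T : H →L[ℂ] H)‖ :=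
          add_le_add (norm_mul_le _ _) (norm_mul_le _ _)
        _ = _ := by ring

/-- The linear space `O_{C,p} = O_C ∩ B_p(H)`. -/
def skewSchattenSubmodule (C : Conjugation H) (p : ℝ≥0∞) [hp : Fact (1 ≤ p)] :
    Submodule ℂ (H →L[ℂ] H) where
  carrier := {X | X ∈ skew C ∧ IsSchatten p X}
  zero_mem' := ⟨zero_mem _, isCompactOperator_zero, by
    have h : IsCompactOperator (0 : H →L[ℂ] H) := isCompactOperator_zero
    have := schattenENorm_smul hp.out h 0
    simp only [zero_smul, enorm_zero, zero_mul] at this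
    rw [this]; exact ENNReal.zero_lt_top⟩
  add_mem' := fun {X Y} hX hY => ⟨add_mem hX.1 hY.1, hX.2.1.add hY.2.1,
    (schattenENorm_add_le hp.out hX.2.1 hY.2.1).trans_lt (ENNReal.add_lt_top.2 ⟨hX.2.2, hY.2.2⟩)⟩
  smul_mem' := fun c X hX => ⟨Submodule.smul_mem _ c hX.1, hX.2.1.smul c,
    (schattenENorm_smul_le hp.out hX.2.1 c).trans_lt (ENNReal.mul_lt_top enorm_lt_top hX.2.2)⟩

/-- `O_{C,p}` as a type of its own, which carries the norm `‖·‖_p` below (and not the operator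
norm). -/
def SkewSchatten (C : Conjugation H) (p : ℝ≥0∞) [Fact (1 ≤ p)] : Type _ :=
  skewSchattenSubmodule C p

namespace SkewSchatten

variable {C : Conjugation H} {p : ℝ≥0∞} [hp : Fact (1 ≤ p)]

instance : AddCommGroup (SkewSchatten C p) :=
  inferInstanceAs (AddCommGroup (skewSchattenSubmodule C p))

instance : Module ℂ (SkewSchatten C p) :=
  inferInstanceAs (Module ℂ (skewSchattenSubmodule C p))

/-- An element of `O_{C,p}`, seen as an operator on `H`. -/
def toOp (X : SkewSchatten C p) : H →L[ℂ] H := X.1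

theorem toOp_add (X Y : SkewSchatten C p) : (X + Y).toOp = X.toOp + Y.toOp := rfl

theorem toOp_smul (c : ℂ) (X : SkewSchatten C p) : (c • X).toOp = c • X.toOp := rfl

theorem toOp_mem (X : SkewSchatten C p) : X.toOp ∈ skew C := X.2.1

theorem toOp_isSchatten (X : SkewSchatten C p) : IsSchatten p X.toOp := X.2.2

theorem toOp_injective : Function.Injective (toOp : SkewSchatten C p → H →L[ℂ] H) :=
  Subtype.val_injective

/-- The norm of `O_{C,p}` is `‖·‖_p`. -/
noncomputable instance : Norm (SkewSchatten C p) where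
  norm X := (schattenENorm p X.toOp).toReal

theorem norm_def (X : SkewSchatten C p) : ‖X‖ = (schattenENorm p X.toOp).toReal := rfl

theorem core : NormedSpace.Core ℂ (SkewSchatten C p) where
  norm_nonneg X := ENNReal.toReal_nonneg
  norm_smul c X := by
    rw [norm_def, norm_def, toOp_smul, schattenENorm_smul hp.out X.toOp_isSchatten.1,
      ENNReal.toReal_mul, toReal_enorm]
  norm_triangle X Y := by
    rw [norm_def, norm_def, norm_def, toOp_add,
      ← ENNReal.toReal_add X.toOp_isSchatten.2.ne Y.toOp_isSchatten.2.ne]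
    exact ENNReal.toReal_mono
      (ENNReal.add_ne_top.2 ⟨X.toOp_isSchatten.2.ne, Y.toOp_isSchatten.2.ne⟩)
      (schattenENorm_add_le hp.out X.toOp_isSchatten.1 Y.toOp_isSchatten.1)
  norm_eq_zero_iff X := by
    rw [norm_def, ENNReal.toReal_eq_zero_iff]
    constructor
    · rintro (h | h)
      · exact toOp_injective (eq_zero_of_schattenENorm hp.out X.toOp_isSchatten.1 h)
      · exact absurd h X.toOp_isSchatten.2.ne
    · rintro rfl
      left
      have h := schattenENorm_smul hp.out (0 : SkewSchatten C p).toOp_isSchatten.1 0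
      rwa [← toOp_smul, smul_zero, enorm_zero, zero_mul] at h

noncomputable instance : NormedAddCommGroup (SkewSchatten C p) := NormedAddCommGroup.ofCore core

noncomputable instance : NormedSpace ℂ (SkewSchatten C p) := NormedSpace.ofCore core

end SkewSchatten

theorem lie_schatten {p : ℝ≥0∞} (hp : 1 ≤ p) (T : H →L[ℂ] H) {X : H →L[ℂ] H}
    (hX : IsCompactOperator X) :
    IsCompactOperator (T * X - X * T) ∧
      schattenENorm p (T * X - X * T) ≤ 2 * ‖T‖ₑ * schattenENorm p X := by
  have h1 : IsCompactOperator (T * X * 1 : H →L[ℂ] H) := (hX.clm_comp T).comp_clm (1 : H →L[ℂ] H)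
  have h2 : IsCompactOperator ((-1 : H →L[ℂ] H) * X * T : H →L[ℂ] H) := (hX.clm_comp (-1 : H →L[ℂ] H)).comp_clm T
  have hsub : T * X - X * T = T * X * 1 + (-1 : H →L[ℂ] H) * X * T := by
    rw [mul_one, neg_one_mul, neg_mul, sub_eq_add_neg]
  rw [hsub]
  refine ⟨h1.add h2, (schattenENorm_add_le hp h1 h2).trans ?_⟩
  have hone : ‖(1 : H →L[ℂ] H)‖ₑ ≤ 1 := by
    rw [← ofReal_norm]
    exact ENNReal.ofReal_le_one.2 ContinuousLinearMap.norm_id_le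
  calc _ ≤ ‖T‖ₑ * schattenENorm p X * ‖(1 : H →L[ℂ] H)‖ₑ +
        ‖(-1 : H →L[ℂ] H)‖ₑ * schattenENorm p X * ‖T‖ₑ :=
        add_le_add (schattenENorm_mul hp hX _ _) (schattenENorm_mul hp hX _ _)
    _ ≤ ‖T‖ₑ * schattenENorm p X * 1 + 1 * schattenENorm p X * ‖T‖ₑ := by
        rw [enorm_neg]; gcongr
    _ = _ := by ring

/-- `ad_{T,p}`, the restriction of `ad_T` to `O_{C,p}`, as a bounded operator on
`(O_{C,p}, ‖·‖_p)`. -/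
noncomputable def adP (C : Conjugation H) (T : skew C) (p : ℝ≥0∞) [hp : Fact (1 ≤ p)] :
    SkewSchatten C p →L[ℂ] SkewSchatten C p :=
  LinearMap.mkContinuous
    { toFun := fun X => ⟨T * X.toOp - X.toOp * T, lie_mem_skew C T.2 X.toOp_mem,
        (lie_schatten hp.out (T : H →L[ℂ] H) X.toOp_isSchatten.1).1,
        (lie_schatten hp.out (T : H →L[ℂ] H) X.toOp_isSchatten.1).2.trans_lt
          (ENNReal.mul_lt_top (ENNReal.mul_lt_top (by simp) enorm_lt_top) X.toOp_isSchatten.2)⟩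
      map_add' := fun X Y => by
        apply SkewSchatten.toOp_injective
        change (T : H →L[ℂ] H) * (X.toOp + Y.toOp) - (X.toOp + Y.toOp) * T =
          (T * X.toOp - X.toOp * T) + (T * Y.toOp - Y.toOp * T)
        rw [mul_add, add_mul]; abel
      map_smul' := fun c X => by
        apply SkewSchatten.toOp_injective
        change (T : H →L[ℂ] H) * (c • X.toOp) - (c • X.toOp) * T =
          c • (T * X.toOp - X.toOp * T)
        rw [mul_smul_comm, smul_mul_assoc, smul_sub] }
    (2 * ‖T‖) fun X => by
      have h := (lie_schatten hp.out (T : H →L[ℂ] H) X.toOp_isSchatten.1).2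
      have h2 := ENNReal.toReal_mono (ENNReal.mul_lt_top
        (ENNReal.mul_lt_top (by simp) enorm_lt_top) X.toOp_isSchatten.2).ne h
      rw [ENNReal.toReal_mul, ENNReal.toReal_mul, toReal_enorm] at h2
      rw [ENNReal.toReal_ofNat] at h2
      exact h2

end Skew

/-- Similarity of bounded operators: `S A = B S` for some invertible bounded operator `S`. -/
def Similar {X₁ X₂ : Type*} [NormedAddCommGroup X₁] [NormedSpace ℂ X₁]
    [NormedAddCommGroup X₂] [NormedSpace ℂ X₂] (A : X₁ →L[ℂ] X₁) (B : X₂ →L[ℂ] X₂) : Prop :=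
  ∃ S : X₁ ≃L[ℂ] X₂, (S : X₁ →L[ℂ] X₂) ∘L A = B ∘L (S : X₁ →L[ℂ] X₂)

/-- The adjoint `A' : X' → X'`, `f ↦ f ∘ A`, on the dual Banach space `X'`. -/
noncomputable def dualOp {X : Type*} [NormedAddCommGroup X] [NormedSpace ℂ X] (A : X →L[ℂ] X) :
    StrongDual ℂ X →L[ℂ] StrongDual ℂ X :=
  ContinuousLinearMap.precomp ℂ A

/-- `A` has trace `t`: for every orthonormal basis `b` of `H`, the sum `∑ ⟨b i, A (b i)⟩` converges
unconditionally to `t`. -/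
def HasTrace.{u} {H : Type u} [NormedAddCommGroup H] [InnerProductSpace ℂ H]
    (A : H →L[ℂ] H) (t : ℂ) : Prop :=
  ∀ (ι : Type u) (b : HilbertBasis ι ℂ H), HasSum (fun i => ⟪b i, A (b i)⟫_ℂ) t

end SkewLie

/-! Write |u⟩⟨v| for the operator b ↦ ⟪v, b⟫ u. The intertwining is cyclicity of the trace: tr(X(TZ
− ZT)) = −tr((TX − XT)Z). The substance is that Z ↦ ψ_Z maps isometrically onto the dual;
`trace_duality` proves this for all conjugate exponents at once, endpoints included.

Let P X = (X − C X* C)/2, the projection onto O_C. It is a contraction in every Schatten norm, so a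
functional f on O_{C,q} extends to f ∘ P on the whole Schatten class without increase of norm. The
bounded form (v, u) ↦ f(P|u⟩⟨v|) is ⟪v, Z u⟫ for an operator Z (`exists_represents`). This Z lies in
O_C, because P sends an operator and its transpose to opposite elements (`Represents.mem_skew`), and
it determines f, because Schmidt truncations approximate in Schatten norm (`Represents.unique`).

Norms are controlled through diagonals ⟪f k, A (e k)⟫ along Bessel systems. Their ℓ^p norms never
exceed ‖A‖_p (`lpENorm_inner_le`), and for compact A and finite p a Schmidt pair attains it. Hence
Hölder's inequality for the trace, which gives ‖ψ_Z‖ ≤ ‖Z‖_p. Conversely, testing f on finite sums ∑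
γ_k |e_k⟩⟨g_k| and using the converse of the scalar Hölder inequality bounds every diagonal of Z by
‖f‖ (`Represents.lpENorm_le`). For p < ∞ such a bound also forces Z to be compact
(`isCompactOperator_of_lpENorm_le`), so Z belongs to the right class and ‖Z‖_p ≤ ‖f‖. -/

namespace SkewLie

open Filter Topology InnerProductSpace

/-! ### Scalar ℓ^p norms and Hölder duality -/

section LpENorm

variable {κ : Type*}

/-- The `ℓ^p` norm of a family in `[0, ∞]`. -/
noncomputable def lpENorm (p : ℝ≥0∞) (a : κ → ℝ≥0∞) : ℝ≥0∞ :=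
  if p = ∞ then ⨆ k, a k else (∑' k, a k ^ p.toReal) ^ (1 / p.toReal)

theorem lpENorm_top (a : κ → ℝ≥0∞) : lpENorm ∞ a = ⨆ k, a k := if_pos rfl

theorem lpENorm_of_ne_top {p : ℝ≥0∞} (h : p ≠ ∞) (a : κ → ℝ≥0∞) :
    lpENorm p a = (∑' k, a k ^ p.toReal) ^ (1 / p.toReal) := if_neg h

theorem lpENorm_one (a : κ → ℝ≥0∞) : lpENorm 1 a = ∑' k, a k := by
  simp [lpENorm_of_ne_top]

theorem le_lpENorm {p : ℝ≥0∞} (hp : 1 ≤ p) (a : κ → ℝ≥0∞) (k : κ) : a k ≤ lpENorm p a := by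
  by_cases h : p = ∞
  · subst h; rw [lpENorm_top]; exact le_iSup a k
  have hp' := one_le_toReal hp h
  rw [lpENorm_of_ne_top h, one_div, ENNReal.le_rpow_inv_iff (by linarith)]
  exact ENNReal.le_tsum (f := fun k => a k ^ p.toReal) k

theorem lpENorm_mono {p : ℝ≥0∞} {a b : κ → ℝ≥0∞} (hab : ∀ k, a k ≤ b k) :
    lpENorm p a ≤ lpENorm p b := by
  unfold lpENorm
  split_ifs
  · exact iSup_mono hab
  · gcongr with k
    exact hab k

theorem lpENorm_le_of_finset [DecidableEq κ] {p M : ℝ≥0∞} (hp : 1 ≤ p) {a : κ → ℝ≥0∞}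
    (h : ∀ F : Finset κ, lpENorm p (fun k => if k ∈ F then a k else 0) ≤ M) :
    lpENorm p a ≤ M := by
  by_cases ht : p = ∞
  · subst ht
    rw [lpENorm_top]
    refine iSup_le fun k => ?_
    have := (le_lpENorm hp (fun j => if j ∈ ({k} : Finset κ) then a j else 0) k).trans (h {k})
    simpa using this
  have hp' := one_le_toReal hp ht
  have hp0 : 0 < p.toReal := by linarith
  rw [lpENorm_of_ne_top ht, one_div, ENNReal.rpow_inv_le_iff hp0, ENNReal.tsum_eq_iSup_sum]
  refine iSup_le fun F => ?_
  have := h F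
  rw [lpENorm_of_ne_top ht, one_div, ENNReal.rpow_inv_le_iff hp0] at this
  refine le_trans (le_of_eq ?_) ((ENNReal.sum_le_tsum F).trans this)
  exact Finset.sum_congr rfl fun k hk => by simp [hk]

theorem one_le_of_inv_add_inv {p q : ℝ≥0∞} (h : p⁻¹ + q⁻¹ = 1) : 1 ≤ p := by
  rw [← ENNReal.inv_le_one]; rw [← h]; exact le_self_add

theorem holderConjugate_toReal {p q : ℝ≥0∞} (h : p⁻¹ + q⁻¹ = 1) (hp : p ≠ ∞) (hq : q ≠ ∞) :
    p.toReal.HolderConjugate q.toReal := by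
  have hp1 := one_le_toReal (one_le_of_inv_add_inv h) hp
  have hq1 := one_le_toReal (one_le_of_inv_add_inv (add_comm p⁻¹ q⁻¹ ▸ h)) hq
  rw [Real.holderConjugate_iff]
  have h2 := congrArg ENNReal.toReal h
  rw [ENNReal.toReal_add (by simp; rintro rfl; simp at hp1; linarith)
      (by simp; rintro rfl; simp at hq1; linarith),
    ENNReal.toReal_inv, ENNReal.toReal_inv, ENNReal.toReal_one] at h2
  refine ⟨?_, h2⟩
  have : 0 < q.toReal⁻¹ := by positivity
  by_contra hle
  have : p.toReal = 1 := by linarith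
  rw [this] at h2
  norm_num at h2
  linarith

theorem tsum_mul_le_lpENorm {p q : ℝ≥0∞} (h : p⁻¹ + q⁻¹ = 1) (a b : κ → ℝ≥0∞) :
    ∑' k, a k * b k ≤ lpENorm p a * lpENorm q b := by
  have key : ∀ (a b : κ → ℝ≥0∞), ∑' k, a k * b k ≤ lpENorm ∞ a * lpENorm 1 b := fun a b => by
    rw [lpENorm_one, ← ENNReal.tsum_mul_left]
    gcongr with k
    exact le_lpENorm le_top a k
  by_cases hp : p = ∞
  · subst hp
    have : q = 1 := by simpa using h
    subst this
    exact key a b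
  by_cases hq : q = ∞
  · subst hq
    have : p = 1 := by simpa using h
    subst this
    simp_rw [mul_comm (a _), mul_comm (lpENorm 1 a)]
    exact key b a
  rw [lpENorm_of_ne_top hp, lpENorm_of_ne_top hq, ENNReal.tsum_eq_iSup_sum]
  refine iSup_le fun F => ?_
  refine (ENNReal.inner_le_Lp_mul_Lq F a b (holderConjugate_toReal h hp hq)).trans ?_
  gcongr
  · exact ENNReal.sum_le_tsum F
  · exact ENNReal.sum_le_tsum F

theorem lpENorm_finset {q : ℝ≥0∞} (hq : 1 ≤ q) (hq' : q ≠ ∞) [DecidableEq κ]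
    (F : Finset κ) (c : κ → ℝ≥0∞) :
    lpENorm q (fun k => if k ∈ F then c k else 0) = (∑ k ∈ F, c k ^ q.toReal) ^ (1 / q.toReal) := by
  have := one_le_toReal hq hq'
  rw [lpENorm_of_ne_top hq', tsum_eq_sum (s := F)]
  · congr 1
    exact Finset.sum_congr rfl fun k hk => by simp [hk]
  · intro k hk
    simp only [hk, if_false]
    exact ENNReal.zero_rpow_of_pos (by linarith)

/-- Converse of the Hölder inequality. -/
theorem lpENorm_le_of_forall_sum [DecidableEq κ] {p q M : ℝ≥0∞} (h : p⁻¹ + q⁻¹ = 1)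
    {a : κ → NNReal}
    (ha : ∀ (F : Finset κ) (c : κ → NNReal),
      ∑ k ∈ F, (a k : ℝ≥0∞) * c k ≤ M * lpENorm q (fun k => if k ∈ F then (c k : ℝ≥0∞) else 0)) :
    lpENorm p (fun k => (a k : ℝ≥0∞)) ≤ M := by
  have hq1 : 1 ≤ q := one_le_of_inv_add_inv (add_comm p⁻¹ q⁻¹ ▸ h)
  have hp1 : 1 ≤ p := one_le_of_inv_add_inv h
  by_cases hp : p = ∞
  · subst hp
    have : q = 1 := by simpa using h
    subst this
    rw [lpENorm_top]
    refine iSup_le fun k => ?_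
    have := ha {k} 1
    rw [lpENorm_finset hq1 ENNReal.one_ne_top] at this
    simpa using this
  refine lpENorm_le_of_finset hp1 fun F => ?_
  rw [lpENorm_finset hp1 hp]
  by_cases hq : q = ∞
  · subst hq
    have : p = 1 := by simpa using h
    subst this
    have := ha F 1
    have h1 : lpENorm ∞
        (fun k => if k ∈ F then (((1 : κ → NNReal) k : NNReal) : ℝ≥0∞) else 0) ≤ 1 := by
      rw [lpENorm_top]
      refine iSup_le fun k => ?_
      split_ifs <;> simp
    simp only [Pi.one_apply, ENNReal.coe_one, mul_one] at this h1
    simp only [ENNReal.toReal_one, ENNReal.rpow_one, one_div_one]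
    exact this.trans ((mul_le_mul_right h1 M).trans (by simp))
  -- The extremal vector of Hölder's inequality on `F`: its ℓ^q norm is at most 1, and pairing with
  -- it returns the ℓ^p norm of `a`.
  obtain ⟨c, hc, hcs⟩ := (NNReal.isGreatest_Lp F a (holderConjugate_toReal h hp hq)).1
  have hq' := one_le_toReal hq1 hq
  have hp' := one_le_toReal hp1 hp
  have h1 := ha F c
  rw [lpENorm_finset hq1 hq] at h1
  have h2 : (∑ k ∈ F, (c k : ℝ≥0∞) ^ q.toReal) ^ (1 / q.toReal) ≤ 1 := by
    refine ENNReal.rpow_le_one ?_ (by positivity)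
    have : (∑ k ∈ F, c k ^ q.toReal) ≤ 1 := hc
    have := ENNReal.coe_le_coe.2 this
    push_cast at this
    convert this using 2 with k
    rw [ENNReal.coe_rpow_of_nonneg _ (by linarith)]
  have h3 : (∑ k ∈ F, (a k : ℝ≥0∞) ^ p.toReal) ^ (1 / p.toReal) = ∑ k ∈ F, (a k : ℝ≥0∞) * c k := by
    have := congrArg (fun t : NNReal => (t : ℝ≥0∞)) hcs
    simp only at this
    rw [ENNReal.coe_rpow_of_nonneg _ (by positivity)] at this
    push_cast at this
    rw [this]
    congr 2 with k
    rw [ENNReal.coe_rpow_of_nonneg _ (by linarith)]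
  rw [h3]
  exact h1.trans ((mul_le_mul_right h2 M).trans (by simp))

/-- For p < ∞ these are tails of a convergent series. For p = ∞ finiteness would not suffice, and
convergence of `a` to zero does the work; for singular numbers it comes from compactness. -/
theorem tendsto_lpENorm_compl {p : ℝ≥0∞} (hp : 1 ≤ p) {a : κ → ℝ≥0∞} (ha : lpENorm p a ≠ ∞)
    (h0 : Tendsto a cofinite (𝓝 0)) [DecidableEq κ] :
    Tendsto (fun F : Finset κ => lpENorm p (fun k => if k ∈ F then 0 else a k)) atTop (𝓝 0) := by
  by_cases ht : p = ∞
  · subst ht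
    rw [ENNReal.tendsto_nhds_zero]
    intro ε hε
    have h1 := ENNReal.tendsto_nhds_zero.1 h0 ε hε
    rw [eventually_cofinite] at h1
    filter_upwards [eventually_ge_atTop h1.toFinset] with F hF
    rw [lpENorm_top]
    refine iSup_le fun k => ?_
    split_ifs with hk
    · exact zero_le
    · by_contra hlt
      exact hk (hF (by simpa using hlt))
  have hp' := one_le_toReal hp ht
  have hp0 : 0 < p.toReal := by linarith
  simp_rw [lpENorm_of_ne_top ht]
  rw [lpENorm_of_ne_top ht] at ha
  have hs : ∑' k, a k ^ p.toReal ≠ ∞ := by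
    intro h
    apply ha
    rw [h]
    exact ENNReal.top_rpow_of_pos (by positivity)
  have h1 := ENNReal.tendsto_tsum_compl_atTop_zero hs
  have h2 : ∀ F : Finset κ, ∑' k, (if k ∈ F then 0 else a k) ^ p.toReal =
      ∑' b : { x // x ∉ F }, a b ^ p.toReal := fun F => by
    rw [← tsum_subtype_eq_of_support_subset (s := {x | x ∉ F})]
    · refine tsum_congr fun b => ?_
      rw [if_neg b.2]
    · intro k hk hkF
      apply hk
      simp [hkF, hp0]
  simp_rw [h2]
  have := h1.ennrpow_const (1 / p.toReal)
  rwa [ENNReal.zero_rpow_of_pos (by positivity)] at this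

end LpENorm

/-! ### Schatten norms and diagonals along Bessel systems -/

section SchattenFamilies

universe u
variable {H : Type u} [NormedAddCommGroup H] [InnerProductSpace ℂ H] [CompleteSpace H]

theorem enorm_inner_symm (a b : H) : ‖⟪a, b⟫_ℂ‖ₑ = ‖⟪b, a⟫_ℂ‖ₑ := by
  rw [← ofReal_norm, ← ofReal_norm, norm_inner_symm]

theorem enorm_inner_le (a b : H) : ‖⟪a, b⟫_ℂ‖ₑ ≤ ‖a‖ₑ * ‖b‖ₑ := by
  rw [← ofReal_norm, ← ofReal_norm, ← ofReal_norm, ← ENNReal.ofReal_mul (norm_nonneg _)]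
  exact ENNReal.ofReal_le_ofReal (norm_inner_le_norm a b)

theorem Bessel.enorm_le {κ : Type*} {e : κ → H} (he : Bessel e) (k : κ) : ‖e k‖ₑ ≤ 1 := by
  have := he.enorm_sq_le k
  rwa [pow_le_one_iff (by simp)] at this

/-- Cauchy–Schwarz in ℓ², followed by the two Bessel inequalities. -/
theorem Bessel.tsum_mul_le {κ : Type*} {e f : κ → H} (he : Bessel e) (hf : Bessel f) (a b : H) :
    ∑' k, ‖⟪e k, a⟫_ℂ‖ₑ * ‖⟪f k, b⟫_ℂ‖ₑ ≤ ‖a‖ₑ * ‖b‖ₑ := by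
  have h : ((2 : ℝ≥0∞)⁻¹ + 2⁻¹) = 1 := ENNReal.inv_two_add_inv_two
  have key : ∀ {e : κ → H} (_ : Bessel e) (a : H), lpENorm 2 (fun k => ‖⟪e k, a⟫_ℂ‖ₑ) ≤ ‖a‖ₑ := by
    intro e he a
    rw [lpENorm_of_ne_top (by simp), ENNReal.toReal_ofNat, one_div,
      ENNReal.rpow_inv_le_iff (by norm_num)]
    have := he a
    simpa using this
  exact (tsum_mul_le_lpENorm h _ _).trans (mul_le_mul' (key he a) (key hf b))

theorem enorm_le_of_enorm_inner_le {A : H →L[ℂ] H} {M : ℝ≥0∞}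
    (h : ∀ a b, ‖⟪a, A b⟫_ℂ‖ₑ ≤ M * (‖a‖ₑ * ‖b‖ₑ)) : ‖A‖ₑ ≤ M := by
  by_cases hc : M = ∞
  · rw [hc]; exact le_top
  rw [← ofReal_norm, ← ENNReal.ofReal_toReal hc]
  refine ENNReal.ofReal_le_ofReal (ContinuousLinearMap.opNorm_le_bound _ ENNReal.toReal_nonneg
    fun b => ?_)
  -- The choice a = A b turns the form bound into ‖A b‖² ≤ M ‖A b‖ ‖b‖.
  have h2 := h (A b) b
  have h3 : ‖⟪A b, A b⟫_ℂ‖ = ‖A b‖ * ‖A b‖ := by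
    rw [inner_self_eq_norm_sq_to_K]; simp [sq]
  rw [← ofReal_norm, h3] at h2
  have h4 := ENNReal.toReal_mono (by finiteness) h2
  rw [ENNReal.toReal_ofReal (by positivity), ENNReal.toReal_mul, ENNReal.toReal_mul,
    toReal_enorm, toReal_enorm] at h4
  by_cases h0 : ‖A b‖ = 0
  · rw [h0]; positivity
  have : 0 < ‖A b‖ := lt_of_le_of_ne (norm_nonneg _) (Ne.symm h0)
  refine le_of_mul_le_mul_left ?_ this
  linarith

/-- An operator dominated by a diagonal family with respect to Bessel systems has Schatten norm at
most the `ℓ^q` norm of the diagonal. -/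
theorem schattenENorm_le_lpENorm {q : ℝ≥0∞} (hq : 1 ≤ q) {A : H →L[ℂ] H}
    (hA : IsCompactOperator A) {κ : Type*} {e f : κ → H} (he : Bessel e) (hf : Bessel f)
    (c : κ → ℝ≥0∞)
    (h : ∀ a b, ‖⟪a, A b⟫_ℂ‖ₑ ≤ ∑' k, c k * (‖⟪e k, a⟫_ℂ‖ₑ * ‖⟪f k, b⟫_ℂ‖ₑ)) :
    schattenENorm q A ≤ lpENorm q c := by
  by_cases ht : q = ∞
  · subst ht
    have h1 : ∀ a b, ‖⟪a, A b⟫_ℂ‖ₑ ≤ lpENorm ∞ c * (‖a‖ₑ * ‖b‖ₑ) := fun a b => by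
      refine (h a b).trans ?_
      calc _ ≤ ∑' k, lpENorm ∞ c * (‖⟪e k, a⟫_ℂ‖ₑ * ‖⟪f k, b⟫_ℂ‖ₑ) := by
            gcongr with k
            exact le_lpENorm le_top c k
        _ ≤ _ := by
            rw [ENNReal.tsum_mul_left]
            gcongr
            exact he.tsum_mul_le hf a b
    rw [schattenENorm, if_pos rfl]
    exact enorm_le_of_enorm_inner_le h1
  have hq' := one_le_toReal hq ht
  rw [schattenENorm, if_neg ht, lpENorm_of_ne_top ht]
  gcongr
  obtain ⟨ι, x, y, hx, hy, htr⟩ := exists_posTrace_eq A hA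
  rw [htr _ hq']
  -- Half the sum of squares dominates the product, and the Bessel inequalities make all row and
  -- column sums at most 1. Jensen's inequality uses the rows; after exchanging the sums, the
  -- columns give the bound by `c`.
  let w : ι → κ → ℝ≥0∞ := fun i k => (‖⟪e k, y i⟫_ℂ‖ₑ ^ 2 + ‖⟪f k, x i⟫_ℂ‖ₑ ^ 2) / 2
  have hhalf : (2 : ℝ≥0∞)⁻¹ * (1 + 1) = 1 := by
    rw [one_add_one_eq_two]; exact ENNReal.inv_mul_cancel (by simp) (by simp)
  have hrow : ∀ i, ∑' k, w i k ≤ 1 := fun i => by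
    simp only [w, ENNReal.div_eq_inv_mul]
    rw [ENNReal.tsum_mul_left, ENNReal.tsum_add, ← hhalf]
    gcongr
    · exact (he _).trans (hy.enorm_sq_le i)
    · exact (hf _).trans (hx.enorm_sq_le i)
  have hcol : ∀ k, ∑' i, w i k ≤ 1 := fun k => by
    simp only [w, ENNReal.div_eq_inv_mul]
    rw [ENNReal.tsum_mul_left, ENNReal.tsum_add, ← hhalf]
    simp_rw [enorm_inner_symm (e k), enorm_inner_symm (f k)]
    gcongr
    · exact (hy _).trans (he.enorm_sq_le k)
    · exact (hx _).trans (hf.enorm_sq_le k)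
  have hterm : ∀ i, ‖⟪y i, A (x i)⟫_ℂ‖ₑ ≤ ∑' k, w i k * c k := fun i => by
    refine (h (y i) (x i)).trans (ENNReal.tsum_le_tsum fun k => ?_)
    rw [mul_comm]
    gcongr
    simp only [w]
    rw [ENNReal.le_div_iff_mul_le (by simp) (by simp), mul_comm]
    exact two_mul_le _ _ (by simp) (by simp)
  calc ∑' i, ‖⟪y i, A (x i)⟫_ℂ‖ₑ ^ q.toReal ≤ ∑' i, ∑' k, w i k * c k ^ q.toReal := by
        refine ENNReal.tsum_le_tsum fun i => ?_
        refine le_trans ?_ (jensen (w i) c (hrow i) _ hq')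
        gcongr
        exact hterm i
    _ = ∑' k, (∑' i, w i k) * c k ^ q.toReal := by
        rw [ENNReal.tsum_comm]
        exact tsum_congr fun k => ENNReal.tsum_mul_right
    _ ≤ ∑' k, c k ^ q.toReal :=
        ENNReal.tsum_le_tsum fun k => mul_le_of_le_one_left zero_le (hcol k)

/-- At p = ∞ this is only the operator norm bound, so compactness is asked for finite p alone. That
form lets the same argument cover all of O_C as the dual of O_{C,1}. -/
theorem lpENorm_inner_le {p : ℝ≥0∞} (hp : 1 ≤ p) {T : H →L[ℂ] H}
    (hT : p ≠ ∞ → IsCompactOperator T) {κ : Type*} {e f : κ → H} (he : Bessel e) (hf : Bessel f) :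
    lpENorm p (fun k => ‖⟪f k, T (e k)⟫_ℂ‖ₑ) ≤ schattenENorm p T := by
  by_cases ht : p = ∞
  · subst ht
    rw [lpENorm_top, schattenENorm, if_pos rfl]
    refine iSup_le fun k => (enorm_inner_le _ _).trans ?_
    calc ‖f k‖ₑ * ‖T (e k)‖ₑ ≤ 1 * (‖T‖ₑ * ‖e k‖ₑ) := by
          gcongr
          · exact hf.enorm_le k
          · exact T.le_opENorm _
      _ ≤ 1 * (‖T‖ₑ * 1) := by
          gcongr
          exact he.enorm_le k
      _ = _ := by simp
  rw [lpENorm_of_ne_top ht, schattenENorm, if_neg ht]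
  gcongr
  exact sum_le_posTrace T (hT ht) _ (one_le_toReal hp ht) e f he hf

/-- An orthonormal basis is carried to a null family by a compact operator. -/
theorem tendsto_compact_basis {ι : Type*} (x : HilbertBasis ι ℂ H) {T : H →L[ℂ] H}
    (hT : IsCompactOperator T) : Tendsto (fun i => T (x i)) cofinite (𝓝 0) := by
  obtain ⟨K, hK, hsub⟩ := hT.image_closedBall_subset_compact 1
  -- All T (x i) lie in a compact set, so it suffices that 0 is the only cluster point z. The family
  -- tends weakly to zero by Bessel's inequality for T* w, which forces ⟪z, z⟫ = 0.
  refine hK.tendsto_nhds_of_unique_mapClusterPt (Eventually.of_forall fun i => hsub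
    ⟨x i, by simp [x.orthonormal.1 i], rfl⟩) fun z _ hz => ?_
  have h1 : ∀ w, Tendsto (fun i => ⟪w, T (x i)⟫_ℂ) cofinite (𝓝 0) := fun w => by
    have h2 := (x.orthonormal.inner_products_summable
      (ContinuousLinearMap.adjoint T w)).tendsto_cofinite_zero
    have h3 : ∀ i, ⟪w, T (x i)⟫_ℂ = ⟪ContinuousLinearMap.adjoint T w, x i⟫_ℂ := fun i =>
      (ContinuousLinearMap.adjoint_inner_left T _ _).symm
    rw [tendsto_zero_iff_norm_tendsto_zero]
    have h4 := (Real.continuous_sqrt.tendsto 0).comp h2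
    rw [Real.sqrt_zero] at h4
    refine h4.congr fun i => ?_
    simp only [Function.comp]
    rw [Real.sqrt_sq (norm_nonneg _), h3, norm_inner_symm]
  have h5 : MapClusterPt ⟪z, z⟫_ℂ cofinite (fun i => ⟪z, T (x i)⟫_ℂ) :=
    MapClusterPt.continuousAt_comp (f := fun v => ⟪z, v⟫_ℂ) (by fun_prop) hz
  have h6 : ⟪z, z⟫_ℂ = 0 := by
    have : ClusterPt ⟪z, z⟫_ℂ (𝓝 (0 : ℂ)) := ClusterPt.mono h5 (h1 z)
    exact eq_of_nhds_neBot this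
  exact inner_self_eq_zero.1 h6

/-- The Schmidt expansion of a compact operator, with its singular numbers. -/
theorem exists_schmidt_expansion (T : H →L[ℂ] H) (hT : IsCompactOperator T) :
    ∃ (ι : Type u) (x : HilbertBasis ι ℂ H) (y : ι → H) (m : ι → ℝ), Bessel y ∧
      (∀ i, 0 ≤ m i) ∧ (∀ i, T (x i) = (m i : ℂ) • y i) ∧ Tendsto m cofinite (𝓝 0) ∧
      ∀ p : ℝ≥0∞, 1 ≤ p → lpENorm p (fun i => ENNReal.ofReal (m i)) ≤ schattenENorm p T := by
  obtain ⟨ι, x, y, m, hy, hm, hTx, hyT, -⟩ := exists_schmidt T hT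
  have hnorm : ∀ i, ‖⟪y i, T (x i)⟫_ℂ‖ = m i := fun i => by
    rw [hyT, Complex.norm_real, Real.norm_of_nonneg (hm i)]
  refine ⟨ι, x, y, m, hy, hm, hTx, ?_, fun p hp => ?_⟩
  · have h1 := (tendsto_compact_basis x hT).norm
    rw [norm_zero] at h1
    refine squeeze_zero hm (fun i => ?_) h1
    rw [← hnorm i]
    refine (norm_inner_le_norm _ _).trans (mul_le_of_le_one_left (norm_nonneg _) ?_)
    have := hy.enorm_le i
    rwa [← ofReal_norm, ENNReal.ofReal_le_one] at this
  · refine le_trans (lpENorm_mono fun i => ?_) (lpENorm_inner_le hp (fun _ => hT)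
      (Bessel.basis x) hy)
    rw [← hnorm i, ofReal_norm]

/-- The weak form of T = ∑ m i |y i⟩⟨x i|, obtained by expanding b in the basis x. Later estimates
use only this form. -/
theorem hasSum_schmidt {T : H →L[ℂ] H} {ι : Type*} (x : HilbertBasis ι ℂ H) {y : ι → H}
    {m : ι → ℝ} (hT : ∀ i, T (x i) = (m i : ℂ) • y i) (a b : H) :
    HasSum (fun i => (m i : ℂ) * (⟪a, y i⟫_ℂ * ⟪x i, b⟫_ℂ)) ⟪a, T b⟫_ℂ := by
  have h := ((x.hasSum_repr b).mapL T).mapL (innerSL ℂ a)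
  have h2 : (fun i => (m i : ℂ) * (⟪a, y i⟫_ℂ * ⟪x i, b⟫_ℂ)) =
      fun i => (innerSL ℂ a) (T (x.repr b i • x i)) := by
    funext i
    simp only [map_smul, hT, innerSL_apply_apply, x.repr_apply_apply, smul_eq_mul]
    ring
  rw [h2]
  exact h

theorem enorm_ofReal_complex {m : ℝ} (hm : 0 ≤ m) : ‖(m : ℂ)‖ₑ = ENNReal.ofReal m := by
  rw [← ofReal_norm, Complex.norm_real, Real.norm_of_nonneg hm]

end SchattenFamilies

/-! ### Finite rank approximation, Hölder's inequality and the trace -/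

section TraceClass

universe u
variable {H : Type u} [NormedAddCommGroup H] [InnerProductSpace ℂ H] [CompleteSpace H]

theorem isCompactOperator_rankOne (u v : H) : IsCompactOperator (rankOne ℂ u v) := by
  have : rankOne ℂ u v = (ContinuousLinearMap.toSpanSingleton ℂ u) ∘L (innerSL ℂ v) := by
    ext z; simp
  rw [this]
  exact (isCompactOperator_of_locallyCompactSpace_dom (innerSL ℂ v)).clm_comp
    (ContinuousLinearMap.toSpanSingleton ℂ u)

section FiniteRank

variable {κ : Type*}

/-- The finite rank operator `∑ c k |e k⟩⟨f k|` over `k ∈ F`. -/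
noncomputable def diagOp (F : Finset κ) (c : κ → ℂ) (e f : κ → H) : H →L[ℂ] H :=
  ∑ k ∈ F, c k • rankOne ℂ (e k) (f k)

theorem diagOp_apply (F : Finset κ) (c : κ → ℂ) (e f : κ → H) (b : H) :
    diagOp F c e f b = ∑ k ∈ F, (c k * ⟪f k, b⟫_ℂ) • e k := by
  simp [diagOp, mul_smul]

theorem inner_diagOp (F : Finset κ) (c : κ → ℂ) (e f : κ → H) (a b : H) :
    ⟪a, diagOp F c e f b⟫_ℂ = ∑ k ∈ F, c k * (⟪a, e k⟫_ℂ * ⟪f k, b⟫_ℂ) := by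
  simp only [diagOp_apply, inner_sum, inner_smul_right]
  exact Finset.sum_congr rfl fun k _ => by ring

theorem isCompactOperator_sum {ι : Type*} (F : Finset ι) {A : ι → H →L[ℂ] H}
    (hA : ∀ i ∈ F, IsCompactOperator (A i)) : IsCompactOperator (∑ i ∈ F, A i : H →L[ℂ] H) := by
  classical
  induction F using Finset.induction_on with
  | empty => exact isCompactOperator_zero
  | insert i F hi ih =>
    rw [Finset.sum_insert hi]
    exact (hA i (Finset.mem_insert_self i F)).add
      (ih fun j hj => hA j (Finset.mem_insert_of_mem hj))

theorem isCompactOperator_diagOp (F : Finset κ) (c : κ → ℂ) (e f : κ → H) :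
    IsCompactOperator (diagOp F c e f) :=
  isCompactOperator_sum F fun k _ => (isCompactOperator_rankOne (e k) (f k)).smul (c k)

theorem schattenENorm_diagOp_le [DecidableEq κ] {q : ℝ≥0∞} (hq : 1 ≤ q) (F : Finset κ)
    (c : κ → ℂ) {e f : κ → H} (he : Bessel e) (hf : Bessel f) :
    schattenENorm q (diagOp F c e f) ≤ lpENorm q (fun k => if k ∈ F then ‖c k‖ₑ else 0) := by
  refine schattenENorm_le_lpENorm hq (isCompactOperator_diagOp F c e f) he hf _ fun a b => ?_
  rw [inner_diagOp, tsum_eq_sum (s := F) (fun k hk => by simp [hk])]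
  refine (enorm_sum_le _ _).trans (le_of_eq (Finset.sum_congr rfl fun k hk => ?_))
  rw [if_pos hk, enorm_mul, enorm_mul, enorm_inner_symm a]

end FiniteRank

/-- The truncations of the Schmidt expansion converge in the Schatten norms. -/
theorem tendsto_schattenENorm_sub_diagOp {q : ℝ≥0∞} (hq : 1 ≤ q) {X : H →L[ℂ] H}
    (hX : IsSchatten q X) {ι : Type*} (x : HilbertBasis ι ℂ H) {y : ι → H} {m : ι → ℝ}
    (hy : Bessel y) (hm : ∀ i, 0 ≤ m i) (hT : ∀ i, X (x i) = (m i : ℂ) • y i)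
    (h0 : Tendsto m cofinite (𝓝 0))
    (hle : lpENorm q (fun i => ENNReal.ofReal (m i)) ≤ schattenENorm q X) :
    Tendsto (fun F : Finset ι => schattenENorm q (X - diagOp F (fun i => (m i : ℂ)) y x))
      atTop (𝓝 0) := by
  classical
  have h1 := tendsto_lpENorm_compl hq (hle.trans_lt hX.2).ne
    (by simpa [Function.comp_def] using (ENNReal.continuous_ofReal.tendsto 0).comp h0)
  refine tendsto_of_tendsto_of_tendsto_of_le_of_le tendsto_const_nhds h1 (fun _ => zero_le)
    fun F => ?_
  refine schattenENorm_le_lpENorm hq (hX.1.sub (isCompactOperator_diagOp _ _ _ _)) hy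
    (Bessel.basis x) _ fun a b => ?_
  -- Subtracting the truncation leaves the Schmidt series with its coefficients in `F` set to zero,
  -- so the ℓ^q norm of the remaining ones bounds the difference.
  have h2 := (hasSum_schmidt x hT a b).sub
    (hasSum_sum_of_ne_finset_zero (s := F)
      (f := fun i => if i ∈ F then (m i : ℂ) * (⟪a, y i⟫_ℂ * ⟪x i, b⟫_ℂ) else 0)
      (fun i hi => by simp [hi]))
  have h3 : ∑ i ∈ F, (if i ∈ F then (m i : ℂ) * (⟪a, y i⟫_ℂ * ⟪x i, b⟫_ℂ) else 0) =
      ⟪a, diagOp F (fun i => (m i : ℂ)) y x b⟫_ℂ := by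
    rw [inner_diagOp]
    exact Finset.sum_congr rfl fun i hi => by simp [hi]
  rw [h3, ← inner_sub_right] at h2
  rw [sub_apply, ← h2.tsum_eq]
  refine enorm_tsum_le_tsum_enorm.trans (ENNReal.tsum_le_tsum fun i => ?_)
  by_cases hi : i ∈ F
  · simp [hi]
  · simp only [hi, if_false, sub_zero]
    rw [enorm_mul, enorm_mul, enorm_inner_symm a, enorm_ofReal_complex (hm i)]

/-- The Hölder inequality for Schatten norms. -/
theorem schattenENorm_one_mul_le {p q : ℝ≥0∞} (h : p⁻¹ + q⁻¹ = 1) {X Z : H →L[ℂ] H}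
    (hX : IsCompactOperator X) (hZ : p ≠ ∞ → IsCompactOperator Z) :
    schattenENorm 1 (X * Z) ≤ schattenENorm q X * schattenENorm p Z := by
  classical
  have hp1 : 1 ≤ p := one_le_of_inv_add_inv h
  have h' : q⁻¹ + p⁻¹ = 1 := add_comm p⁻¹ q⁻¹ ▸ h
  have hq1 : 1 ≤ q := one_le_of_inv_add_inv h'
  obtain ⟨ι, u, v, s, hv, hs, -, hvT, htr⟩ := exists_schmidt (X * Z) (hX.comp_clm Z)
  obtain ⟨ι', x, y, m, hy, hm, hXx, -, hle⟩ := exists_schmidt_expansion X hX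
  have hn : schattenENorm 1 (X * Z) = ∑' i, ENNReal.ofReal (s i) := by
    have := htr 1 le_rfl
    simp only [Real.rpow_one] at this
    rw [schattenENorm, if_neg ENNReal.one_ne_top]
    simpa using this
  rw [hn, ENNReal.tsum_eq_iSup_sum]
  refine iSup_le fun F => ?_
  -- With u, v, s a Schmidt decomposition of X Z, this contraction W = ∑ |u i⟩⟨v i| collects the
  -- partial sum of singular numbers into one diagonal: ∑ s i = ∑ m j ⟪x j, Z W (y j)⟫. Scalar
  -- Hölder then separates the singular numbers of X from a diagonal of Z.
  let W : H →L[ℂ] H := diagOp F (fun _ => 1) u v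
  have hW : ‖W‖ ≤ 1 := by
    have h1 := schattenENorm_diagOp_le le_top F (fun _ => 1) (Bessel.basis u) hv
    rw [schattenENorm, if_pos rfl, lpENorm_top] at h1
    have h2 : ‖W‖ₑ ≤ 1 := h1.trans (iSup_le fun k => by split_ifs <;> simp)
    rwa [← ofReal_norm, ENNReal.ofReal_le_one] at h2
  have h1 : HasSum (fun j => (m j : ℂ) * ⟪x j, Z (W (y j))⟫_ℂ) (∑ i ∈ F, (s i : ℂ)) := by
    have h2 := hasSum_sum (s := F) fun i _ => hasSum_schmidt x hXx (v i) (Z (u i))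
    have h3 : ∑ i ∈ F, ⟪v i, X (Z (u i))⟫_ℂ = ∑ i ∈ F, (s i : ℂ) :=
      Finset.sum_congr rfl fun i _ => hvT i
    rw [h3] at h2
    convert! h2 using 1
    funext j
    simp only [W, diagOp_apply, map_sum, map_smul, inner_sum, inner_smul_right, Finset.mul_sum,
      one_mul]
  have h4 : ∑ i ∈ F, ENNReal.ofReal (s i) = ‖∑ i ∈ F, (s i : ℂ)‖ₑ := by
    rw [← Complex.ofReal_sum, enorm_ofReal_complex (Finset.sum_nonneg fun i _ => hs i),
      ENNReal.ofReal_sum_of_nonneg fun i _ => hs i]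
  rw [h4, ← h1.tsum_eq]
  calc _ ≤ ∑' j, ENNReal.ofReal (m j) * ‖⟪x j, Z (W (y j))⟫_ℂ‖ₑ := by
        refine enorm_tsum_le_tsum_enorm.trans (ENNReal.tsum_le_tsum fun j => ?_)
        rw [enorm_mul, enorm_ofReal_complex (hm j)]
    _ ≤ _ := tsum_mul_le_lpENorm h' _ _
    _ ≤ _ := mul_le_mul' (hle q hq1)
        (lpENorm_inner_le hp1 hZ (hy.comp W hW) (Bessel.basis x))

/-- Expand A by Schmidt and D* (x i), y i in a basis b. The double family is absolutely summable
since ∑ m i < ∞, so it may be summed in either order: one gives the trace of A D along b, the other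
the trace of D A along x. This yields basis independence and cyclicity together. -/
theorem hasTrace_mul_aux {A : H →L[ℂ] H} (hA : IsSchatten 1 A) (D : H →L[ℂ] H) :
    ∃ (ι : Type u) (x : HilbertBasis ι ℂ H) (t : ℂ),
      HasTrace (A * D) t ∧ HasSum (fun i => ⟪x i, (D * A) (x i)⟫_ℂ) t := by
  obtain ⟨ι, x, y, m, hy, hm, hAx, -, hle⟩ := exists_schmidt_expansion A hA.1
  have hle1 := (hle 1 le_rfl).trans_lt hA.2
  rw [lpENorm_one] at hle1
  have hval : ∀ i, ⟪x i, (D * A) (x i)⟫_ℂ = m i * ⟪ContinuousLinearMap.adjoint D (x i), y i⟫_ℂ :=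
    fun i => by
      rw [mul_apply_eq_comp, hAx, map_smul, inner_smul_right, ContinuousLinearMap.adjoint_inner_left]
  have hbound : ∀ i, ‖y i‖ₑ * ‖ContinuousLinearMap.adjoint D (x i)‖ₑ ≤ ‖D‖ₑ := fun i => by
    calc _ ≤ 1 * (‖ContinuousLinearMap.adjoint D‖ₑ * ‖x i‖ₑ) := by
          gcongr
          · exact hy.enorm_le i
          · exact ContinuousLinearMap.le_opENorm _ _
      _ ≤ 1 * (‖ContinuousLinearMap.adjoint D‖ₑ * 1) := by
          gcongr
          exact (Bessel.basis x).enorm_le i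
      _ = _ := by
          rw [one_mul, mul_one, ← ofReal_norm, ← ofReal_norm, LinearIsometryEquiv.norm_map]
  have hmain : ∀ (ι' : Type u) (b : HilbertBasis ι' ℂ H),
      ∃ t, HasSum (fun j => ⟪b j, (A * D) (b j)⟫_ℂ) t ∧
        HasSum (fun i => ⟪x i, (D * A) (x i)⟫_ℂ) t := by
    intro ι' b
    let g : ι × ι' → ℂ := fun s =>
      m s.1 * (⟪b s.2, y s.1⟫_ℂ * ⟪ContinuousLinearMap.adjoint D (x s.1), b s.2⟫_ℂ)
    have hg : Summable g := by
      refine Summable.of_enorm ?_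
      refine ne_of_lt (lt_of_le_of_lt ?_ (ENNReal.mul_lt_top hle1 (enorm_lt_top (x := D))))
      rw [ENNReal.tsum_prod', ← ENNReal.tsum_mul_right]
      refine ENNReal.tsum_le_tsum fun i => ?_
      simp only [g, enorm_mul]
      rw [ENNReal.tsum_mul_left, enorm_ofReal_complex (hm i)]
      gcongr
      refine le_trans (le_of_eq (tsum_congr fun j => ?_))
        (((Bessel.basis b).tsum_mul_le (Bessel.basis b) (y i)
          (ContinuousLinearMap.adjoint D (x i))).trans (hbound i))
      rw [enorm_inner_symm (b j) (ContinuousLinearMap.adjoint D (x i))]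
    refine ⟨∑' s, g s, ?_, ?_⟩
    · have h1 := (Equiv.prodComm ι' ι).hasSum_iff.2 hg.hasSum
      refine h1.prod_fiberwise fun j => ?_
      have h2 := hasSum_schmidt x hAx (b j) (D (b j))
      simpa [g, ContinuousLinearMap.adjoint_inner_left] using h2
    · refine hg.hasSum.prod_fiberwise fun i => ?_
      rw [hval]
      have h2 := (b.hasSum_inner_mul_inner (ContinuousLinearMap.adjoint D (x i)) (y i)).mul_left
        (m i : ℂ)
      simpa [g, mul_comm] using h2
  obtain ⟨t, -, ht⟩ := hmain _ x
  -- The sum along x does not involve `b`, so every basis yields the same value.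
  refine ⟨ι, x, t, fun ι' b => ?_, ht⟩
  obtain ⟨t', h1, h2⟩ := hmain ι' b
  rwa [h2.unique ht] at h1

/-- The trace of a trace class operator. -/
noncomputable def trace (A : H →L[ℂ] H) : ℂ := ∑' i, ⟪stdBasis H i, A (stdBasis H i)⟫_ℂ

theorem HasTrace.trace_eq {A : H →L[ℂ] H} {t : ℂ} (h : HasTrace A t) : trace A = t :=
  (h _ (stdBasis H)).tsum_eq

theorem hasTrace_trace {A : H →L[ℂ] H} (hA : IsSchatten 1 A) : HasTrace A (trace A) := by
  obtain ⟨ι, x, t, ht, -⟩ := hasTrace_mul_aux hA 1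
  rw [mul_one] at ht
  rwa [ht.trace_eq]

theorem IsSchatten.mul {p : ℝ≥0∞} (hp : 1 ≤ p) {A : H →L[ℂ] H} (hA : IsSchatten p A)
    (B D : H →L[ℂ] H) : IsSchatten p (B * A * D) :=
  ⟨(hA.1.clm_comp B).comp_clm D, (schattenENorm_mul hp hA.1 B D).trans_lt
    (ENNReal.mul_lt_top (ENNReal.mul_lt_top enorm_lt_top hA.2) enorm_lt_top)⟩

theorem trace_mul_comm {A : H →L[ℂ] H} (hA : IsSchatten 1 A) (D : H →L[ℂ] H) :
    trace (A * D) = trace (D * A) := by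
  obtain ⟨ι, x, t, ht, hx⟩ := hasTrace_mul_aux hA D
  have h1 : IsSchatten 1 (D * A) := by simpa using hA.mul le_rfl D 1
  rw [ht.trace_eq]
  exact hx.unique (hasTrace_trace h1 _ x)

theorem HasTrace.add {A B : H →L[ℂ] H} {s t : ℂ} (hA : HasTrace A s) (hB : HasTrace B t) :
    HasTrace (A + B) (s + t) := fun ι b => by
  simpa [inner_add_right] using (hA ι b).add (hB ι b)

theorem HasTrace.smul {A : H →L[ℂ] H} {s : ℂ} (hA : HasTrace A s) (c : ℂ) :
    HasTrace (c • A) (c * s) := fun ι b => by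
  simpa [inner_smul_right] using (hA ι b).mul_left c

theorem HasTrace.sub {A B : H →L[ℂ] H} {s t : ℂ} (hA : HasTrace A s) (hB : HasTrace B t) :
    HasTrace (A - B) (s - t) := fun ι b => by
  simpa [inner_sub_right] using (hA ι b).sub (hB ι b)

theorem enorm_trace_le {A : H →L[ℂ] H} (hA : IsCompactOperator A) :
    ‖trace A‖ₑ ≤ schattenENorm 1 A := by
  refine enorm_tsum_le_tsum_enorm.trans ?_
  have := lpENorm_inner_le le_rfl (fun _ => hA) (Bessel.basis (stdBasis H))
    (Bessel.basis (stdBasis H))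
  rwa [lpENorm_one] at this

theorem hasTrace_rankOne_mul (u v : H) (Z : H →L[ℂ] H) :
    HasTrace (rankOne ℂ u v * Z) ⟪v, Z u⟫_ℂ := fun ι b => by
  have h := b.hasSum_inner_mul_inner (ContinuousLinearMap.adjoint Z v) u
  rw [ContinuousLinearMap.adjoint_inner_left] at h
  simpa [inner_smul_right, ContinuousLinearMap.adjoint_inner_left] using h

end TraceClass

/-! ### The transpose and the projection onto O_C -/

section Transpose

universe u
variable {H : Type u} [NormedAddCommGroup H] [InnerProductSpace ℂ H] [CompleteSpace H]
  (C : Conjugation H)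

theorem Conjugation.inner_left (x y : H) : ⟪C.toFun x, y⟫_ℂ = ⟪C.toFun y, x⟫_ℂ := by
  rw [← C.inner_map_map' x (C.toFun y), C.involutive']

theorem Conjugation.inner_right (x y : H) : ⟪x, C.toFun y⟫_ℂ = ⟪y, C.toFun x⟫_ℂ := by
  rw [← C.inner_map_map' (C.toFun x) y, C.involutive']

theorem Conjugation.norm_map (x : H) : ‖C.toFun x‖ = ‖x‖ := by
  have h := C.inner_map_map' x x
  rw [inner_self_eq_norm_sq_to_K, inner_self_eq_norm_sq_to_K] at h
  have h2 : ‖C.toFun x‖ ^ 2 = ‖x‖ ^ 2 := by exact_mod_cast h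
  exact (sq_eq_sq₀ (norm_nonneg _) (norm_nonneg _)).1 h2

theorem Bessel.conj {κ : Type*} {e : κ → H} (he : Bessel e) : Bessel fun k => C.toFun (e k) := by
  intro z
  have h := he (C.toFun z)
  simp_rw [enorm_inner_symm (e _) (C.toFun z), C.inner_left z] at h
  rwa [← ofReal_norm (C.toFun z), C.norm_map, ofReal_norm] at h

/-- The transpose `C X* C` of an operator, with respect to the conjugation `C`. -/
noncomputable def transpose : (H →L[ℂ] H) →ₗ[ℂ] (H →L[ℂ] H) where
  toFun X := LinearMap.mkContinuous
    { toFun := fun x => C.toFun (ContinuousLinearMap.adjoint X (C.toFun x))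
      map_add' := fun x y => by rw [C.map_add', map_add, C.map_add']
      map_smul' := fun c x => by
        rw [C.map_smul', map_smul, C.map_smul', Complex.conj_conj, RingHom.id_apply] } ‖X‖
    fun x => by
      change ‖C.toFun _‖ ≤ _
      rw [C.norm_map]
      refine (ContinuousLinearMap.le_opNorm _ _).trans ?_
      rw [C.norm_map, LinearIsometryEquiv.norm_map]
  map_add' X Y := by
    ext x
    change C.toFun _ = C.toFun _ + C.toFun _
    rw [map_add, add_apply, C.map_add']
  map_smul' c X := by
    ext x
    change C.toFun _ = c • C.toFun _
    rw [map_smulₛₗ, smul_apply, C.map_smul', Complex.conj_conj]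

theorem inner_transpose (X : H →L[ℂ] H) (a b : H) :
    ⟪a, transpose C X b⟫_ℂ = ⟪C.toFun b, X (C.toFun a)⟫_ℂ := by
  change ⟪a, C.toFun (ContinuousLinearMap.adjoint X (C.toFun b))⟫_ℂ = _
  rw [C.inner_right, ContinuousLinearMap.adjoint_inner_left]

theorem norm_transpose_le (X : H →L[ℂ] H) : ‖transpose C X‖ ≤ ‖X‖ :=
  ContinuousLinearMap.opNorm_le_bound _ (norm_nonneg _) fun x => by
    change ‖C.toFun _‖ ≤ _
    rw [C.norm_map]
    refine (ContinuousLinearMap.le_opNorm _ _).trans ?_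
    rw [C.norm_map, LinearIsometryEquiv.norm_map]

/-- Replacing a by C a shows the meaning: the bilinear form (a, b) ↦ ⟪C a, X b⟫ is antisymmetric. -/
theorem mem_skew_iff {X : H →L[ℂ] H} :
    X ∈ skew C ↔ ∀ a b, ⟪C.toFun b, X (C.toFun a)⟫_ℂ = -⟪a, X b⟫_ℂ := by
  have h1 : ∀ a b, ⟪C.toFun b, X (C.toFun a)⟫_ℂ = ⟪C.toFun (X (C.toFun a)), b⟫_ℂ := fun a b =>
    C.inner_left _ _
  have h2 : ∀ a b, ⟪a, X b⟫_ℂ = ⟪ContinuousLinearMap.adjoint X a, b⟫_ℂ := fun a b =>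
    (ContinuousLinearMap.adjoint_inner_left X b a).symm
  simp_rw [h1, h2, ← inner_neg_left]
  exact ⟨fun h a b => by rw [h a], fun h a => ext_inner_right ℂ (h a)⟩

theorem transpose_diagOp {κ : Type*} (F : Finset κ) (c : κ → ℂ) (e f : κ → H) :
    transpose C (diagOp F c e f) =
      diagOp F c (fun k => C.toFun (f k)) (fun k => C.toFun (e k)) := by
  ext b
  refine ext_inner_left ℂ fun a => ?_
  rw [inner_transpose, inner_diagOp, inner_diagOp]
  refine Finset.sum_congr rfl fun k _ => ?_
  rw [C.inner_left b, C.inner_right _ a, mul_comm ⟪C.toFun (e k), b⟫_ℂ]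

/-- The transpose is norm-decreasing and preserves finite rank, so the transposed Schmidt
truncations converge in norm to the transpose of X. -/
theorem isCompactOperator_transpose {X : H →L[ℂ] H} (hX : IsCompactOperator X) :
    IsCompactOperator (transpose C X) := by
  obtain ⟨ι, x, y, m, hy, hm, hXx, h0, hle⟩ := exists_schmidt_expansion X hX
  have hS : IsSchatten ∞ X := ⟨hX, by rw [schattenENorm, if_pos rfl]; exact enorm_lt_top⟩
  have h1 := tendsto_schattenENorm_sub_diagOp le_top hS x hy hm hXx h0 (hle ∞ le_top)
  simp only [schattenENorm, if_true] at h1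
  refine isCompactOperator_of_tendsto (l := atTop)
    (F := fun F : Finset ι => SkewLie.transpose C (diagOp F (fun i => (m i : ℂ)) y x)) ?_ ?_
  · rw [tendsto_iff_edist_tendsto_0]
    refine tendsto_of_tendsto_of_tendsto_of_le_of_le tendsto_const_nhds h1 (fun _ => zero_le)
      fun F => ?_
    rw [edist_comm, edist_eq_enorm_sub, ← map_sub, ← ofReal_norm, ← ofReal_norm]
    exact ENNReal.ofReal_le_ofReal (norm_transpose_le C _)
  · refine Eventually.of_forall fun F => ?_
    rw [transpose_diagOp]
    exact isCompactOperator_diagOp _ _ _ _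

/-- Transposing the Schmidt expansion gives ∑ m i |C (x i)⟩⟨C (y i)|: the coefficients are unchanged
and the systems are still Bessel. -/
theorem schattenENorm_transpose_le {q : ℝ≥0∞} (hq : 1 ≤ q) {X : H →L[ℂ] H}
    (hX : IsCompactOperator X) : schattenENorm q (transpose C X) ≤ schattenENorm q X := by
  obtain ⟨ι, x, y, m, hy, hm, hXx, -, hle⟩ := exists_schmidt_expansion X hX
  refine le_trans ?_ (hle q hq)
  refine schattenENorm_le_lpENorm hq (isCompactOperator_transpose C hX)
    ((Bessel.basis x).conj C) (hy.conj C) _ fun a b => ?_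
  rw [inner_transpose, ← (hasSum_schmidt x hXx _ _).tsum_eq]
  refine enorm_tsum_le_tsum_enorm.trans (ENNReal.tsum_le_tsum fun i => ?_)
  rw [enorm_mul, enorm_mul, enorm_ofReal_complex (hm i), C.inner_left b, C.inner_right _ a,
    enorm_inner_symm a, mul_comm ‖⟪C.toFun (y i), b⟫_ℂ‖ₑ]

/-- The projection `X ↦ (X - C X* C) / 2` of `B(H)` onto `O_C`. -/
noncomputable def skewPart : (H →L[ℂ] H) →ₗ[ℂ] (H →L[ℂ] H) :=
  (2⁻¹ : ℂ) • (LinearMap.id - transpose C)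

theorem skewPart_apply (X : H →L[ℂ] H) : skewPart C X = (2⁻¹ : ℂ) • (X - transpose C X) := rfl

theorem inner_skewPart (X : H →L[ℂ] H) (a b : H) :
    ⟪a, skewPart C X b⟫_ℂ = 2⁻¹ * (⟪a, X b⟫_ℂ - ⟪C.toFun b, X (C.toFun a)⟫_ℂ) := by
  rw [skewPart_apply, smul_apply, inner_smul_right, sub_apply, inner_sub_right, inner_transpose]

theorem skewPart_mem (X : H →L[ℂ] H) : skewPart C X ∈ skew C := by
  rw [mem_skew_iff]
  intro a b
  rw [inner_skewPart, inner_skewPart, C.involutive', C.involutive']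
  ring

theorem skewPart_eq_self {X : H →L[ℂ] H} (hX : X ∈ skew C) : skewPart C X = X := by
  ext b
  refine ext_inner_left ℂ fun a => ?_
  rw [inner_skewPart, (mem_skew_iff C).1 hX]
  ring

/-- Contractivity makes the duality isometric: a constant larger than 1 here would reappear in the
bound of ‖Z‖_p by ‖f‖. -/
theorem IsSchatten.skewPart {q : ℝ≥0∞} (hq : 1 ≤ q) {X : H →L[ℂ] H} (hX : IsSchatten q X) :
    IsSchatten q (skewPart C X) ∧ schattenENorm q (SkewLie.skewPart C X) ≤ schattenENorm q X := by
  have hc := hX.1.sub (isCompactOperator_transpose C hX.1)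
  have h1 : schattenENorm q (SkewLie.skewPart C X) ≤ schattenENorm q X := by
    rw [skewPart_apply, schattenENorm_smul hq hc]
    have h2 : schattenENorm q (X - transpose C X) ≤ schattenENorm q X + schattenENorm q X := by
      have h3 : IsCompactOperator ((-1 : ℂ) • transpose C X : H →L[ℂ] H) :=
        (isCompactOperator_transpose C hX.1).smul (-1 : ℂ)
      have h4 := schattenENorm_add_le hq hX.1 h3
      rw [schattenENorm_smul hq (isCompactOperator_transpose C hX.1)] at h4
      rw [neg_one_smul, ← sub_eq_add_neg, enorm_neg, enorm_one, one_mul] at h4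
      exact h4.trans (add_le_add_right (schattenENorm_transpose_le C hq hX.1) _)
    calc _ ≤ ‖(2⁻¹ : ℂ)‖ₑ * (schattenENorm q X + schattenENorm q X) := by gcongr
      _ = schattenENorm q X := by
        have : ‖(2⁻¹ : ℂ)‖ₑ = 2⁻¹ := by
          rw [enorm_inv two_ne_zero, ← ofReal_norm]
          simp
        rw [this, ← two_mul, ← mul_assoc, ENNReal.inv_mul_cancel (by simp) (by simp), one_mul]
  exact ⟨⟨hc.smul _, h1.trans_lt hX.2⟩, h1⟩

/-- The Schatten class as a linear space. -/
def schattenSubmodule (H : Type u) [NormedAddCommGroup H] [InnerProductSpace ℂ H]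
    [CompleteSpace H] (q : ℝ≥0∞) [hq : Fact (1 ≤ q)] : Submodule ℂ (H →L[ℂ] H) where
  carrier := {X | IsSchatten q X}
  zero_mem' := ⟨isCompactOperator_zero, by
    have := schattenENorm_smul hq.out (T := (0 : H →L[ℂ] H)) isCompactOperator_zero 0
    simp only [zero_smul, enorm_zero, zero_mul] at this
    rw [this]; exact ENNReal.zero_lt_top⟩
  add_mem' := fun {X Y} hX hY => ⟨hX.1.add hY.1,
    (schattenENorm_add_le hq.out hX.1 hY.1).trans_lt (ENNReal.add_lt_top.2 ⟨hX.2, hY.2⟩)⟩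
  smul_mem' := fun c X hX => ⟨hX.1.smul c,
    (schattenENorm_smul_le hq.out hX.1 c).trans_lt (ENNReal.mul_lt_top enorm_lt_top hX.2)⟩

end Transpose

/-! ### Compactness and Schatten norm from bounds on diagonals -/

section Compactness

universe u
variable {H : Type u} [NormedAddCommGroup H] [InnerProductSpace ℂ H] [CompleteSpace H]

theorem Bessel.of_orthonormal {κ : Type*} {e : κ → H} (he : Orthonormal ℂ e) : Bessel e := by
  intro z
  have h2 := ENNReal.ofReal_le_ofReal (he.tsum_inner_products_le z)
  rw [ENNReal.ofReal_tsum_of_nonneg (fun i => by positivity) (he.inner_products_summable z)] at h2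
  simpa only [ENNReal.ofReal_pow (norm_nonneg _), ofReal_norm] using h2

theorem Bessel.const {e : H} (he : ‖e‖ ≤ 1) : Bessel fun _ : Unit => e := by
  intro z
  rw [tsum_fintype, Fintype.sum_unique]
  gcongr
  refine (enorm_inner_le _ _).trans (mul_le_of_le_one_left zero_le ?_)
  rwa [← ofReal_norm, ENNReal.ofReal_le_one]

/-- There are maximal orthonormal sets on which a bounded operator is bounded below. -/
theorem exists_maximal_orthonormal_le_norm (Z : H →L[ℂ] H) (δ : ℝ) :
    ∃ S : Set H, Orthonormal ℂ (Subtype.val : S → H) ∧ (∀ e ∈ S, δ ≤ ‖Z e‖) ∧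
      ∀ e : H, ‖e‖ = 1 → (∀ s ∈ S, ⟪s, e⟫_ℂ = 0) → ‖Z e‖ < δ := by
  obtain ⟨S, hS⟩ := zorn_subset
    {S : Set H | Orthonormal ℂ (Subtype.val : S → H) ∧ ∀ e ∈ S, δ ≤ ‖Z e‖} (by
      intro c hc hchain
      refine ⟨⋃₀ c, ⟨orthonormal_sUnion_of_directed hchain.directedOn fun a ha => (hc ha).1, ?_⟩,
        fun s hs => Set.subset_sUnion_of_mem hs⟩
      rintro e ⟨a, ha, hea⟩
      exact (hc ha).2 e hea)
  refine ⟨S, hS.prop.1, hS.prop.2, fun e he hort => ?_⟩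
  by_contra hlt
  rw [not_lt] at hlt
  have hnot : e ∉ S := fun h => by
    have := hort e h
    rw [inner_self_eq_zero] at this
    simp [this] at he
  have hmem : insert e S ⊆ S := hS.2 ⟨?_, ?_⟩ (Set.subset_insert e S)
  · exact hnot (hmem (Set.mem_insert e S))
  · constructor
    · rintro ⟨a, rfl | ha⟩
      · exact he
      · exact hS.prop.1.1 ⟨a, ha⟩
    · rintro ⟨a, ha⟩ ⟨b, hb⟩ hab
      have hab' : a ≠ b := fun h => hab (Subtype.ext h)
      rcases ha with rfl | ha <;> rcases hb with rfl | hb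
      · exact absurd rfl hab'
      · exact inner_eq_zero_symm.1 (hort b hb)
      · exact hort a ha
      · exact hS.prop.1.2 (i := ⟨a, ha⟩) (j := ⟨b, hb⟩) (fun h => hab' (congrArg Subtype.val h))
  · rintro a (rfl | ha)
    · exact hlt
    · exact hS.prop.2 a ha

/-- An operator whose diagonals along Bessel systems are bounded in `ℓ^p`, `p < ∞`, is compact. -/
theorem isCompactOperator_of_lpENorm_le {p : ℝ≥0∞} (hp : 1 ≤ p) (ht : p ≠ ∞) {Z : H →L[ℂ] H}
    {M : ℝ≥0∞} (hM : M ≠ ∞)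
    (h : ∀ (κ : Type u) (e f : κ → H), Bessel e → Bessel f →
      lpENorm p (fun k => ‖⟪f k, Z (e k)⟫_ℂ‖ₑ) ≤ M) : IsCompactOperator Z := by
  by_cases hZ : Z = 0
  · subst hZ; exact isCompactOperator_zero
  have hZn : 0 < ‖Z‖ := norm_pos_iff.2 hZ
  have hp' := one_le_toReal hp ht
  have hp0 : 0 < p.toReal := by linarith
  refine isClosed_setOfPred_isCompactOperator.closure_subset
    (Metric.mem_closure_iff.2 fun ε hε => ?_)
  obtain ⟨S, hS, hSδ, hmax⟩ := exists_maximal_orthonormal_le_norm Z (ε / 2)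
  -- For the systems e = s and f = Z s / ‖Z‖, s ∈ S, each diagonal entry is at least (ε/2)² / ‖Z‖;
  -- infinitely many of them contradict the ℓ^p bound.
  have hfin : Finite S := by
    by_contra hinf
    rw [not_finite_iff_infinite] at hinf
    let B : H →L[ℂ] H := ((‖Z‖⁻¹ : ℝ) : ℂ) • Z
    have hB : ‖B‖ ≤ 1 := by
      simp only [B, norm_smul, Complex.norm_real, norm_inv, norm_norm]
      exact (inv_mul_cancel₀ hZn.ne').le
    have h1 := h S Subtype.val (fun s => B s) (Bessel.of_orthonormal hS)
      ((Bessel.of_orthonormal hS).comp B hB)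
    rw [lpENorm_of_ne_top ht, one_div, ENNReal.rpow_inv_le_iff hp0] at h1
    have h2 : ∀ s : S, ENNReal.ofReal (‖Z‖⁻¹ * (ε / 2) ^ 2) ^ p.toReal ≤
        ‖⟪B s, Z s⟫_ℂ‖ₑ ^ p.toReal := fun s => by
      gcongr
      rw [← ofReal_norm]
      apply ENNReal.ofReal_le_ofReal
      simp only [B, smul_apply, inner_smul_left, inner_self_eq_norm_sq_to_K]
      rw [norm_mul, Complex.conj_ofReal, Complex.norm_real, norm_inv, norm_norm, norm_pow]
      simp only [RCLike.norm_ofReal, abs_norm]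
      have := hSδ s s.2
      gcongr
    have h3 := (ENNReal.tsum_le_tsum h2).trans h1
    rw [ENNReal.tsum_const_eq_top_of_ne_zero] at h3
    · exact (ENNReal.rpow_lt_top_of_nonneg hp0.le hM).ne (top_le_iff.1 h3)
    · refine (ENNReal.rpow_pos (ENNReal.ofReal_pos.2 (by positivity)) ENNReal.ofReal_ne_top).ne'
  let V : Submodule ℂ H := Submodule.span ℂ S
  have hV : FiniteDimensional ℂ V := FiniteDimensional.span_of_finite ℂ (Set.toFinite S)
  -- Maximality of S says that Z is bounded by ε/2 on the orthogonal complement of V, which bounds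
  -- the error of this finite rank approximant.
  refine ⟨Z ∘L V.starProjection, ?_, ?_⟩
  · have h1 : IsCompactOperator (Z ∘L V.subtypeL) :=
      isCompactOperator_of_locallyCompactSpace_rng (Z ∘L V.subtypeL)
    exact h1.comp_clm V.orthogonalProjectionOnto
  · rw [dist_eq_norm]
    refine lt_of_le_of_lt (ContinuousLinearMap.opNorm_le_bound _ (by positivity) fun b => ?_)
      (half_lt_self hε)
    rw [sub_apply, ContinuousLinearMap.comp_apply, ← map_sub]
    set a := b - V.starProjection b with ha
    have hort : a ∈ Vᗮ := Submodule.sub_starProjection_mem_orthogonal b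
    have hab : ‖a‖ ≤ ‖b‖ := by
      have : a = Vᗮ.starProjection b := by
        rw [Submodule.starProjection_orthogonal]; rfl
      rw [this]
      exact Vᗮ.norm_starProjection_apply_le b
    have h1 : ‖Z a‖ ≤ ε / 2 * ‖a‖ := by
      by_cases ha0 : a = 0
      · simp [ha0]
      have hn : 0 < ‖a‖ := norm_pos_iff.2 ha0
      have h2 := hmax (((‖a‖⁻¹ : ℝ) : ℂ) • a) (by
        rw [norm_smul, Complex.norm_real, norm_inv, norm_norm, inv_mul_cancel₀ hn.ne'])
        fun s hs => by
          rw [inner_smul_right, hort s (Submodule.subset_span hs), mul_zero]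
      rw [map_smul, norm_smul, Complex.norm_real, norm_inv, norm_norm, inv_mul_lt_iff₀ hn] at h2
      linarith
    exact h1.trans (by gcongr)

/-- For p < ∞ compactness comes first, because only then is there a Schmidt pair whose diagonal
attains the norm. For p = ∞ the form bound is used instead. -/
theorem schattenENorm_le_of_lpENorm_le {p : ℝ≥0∞} (hp : 1 ≤ p) {Z : H →L[ℂ] H}
    {M : ℝ≥0∞} (hM : M ≠ ∞) (htop : ∀ a b, ‖⟪a, Z b⟫_ℂ‖ₑ ≤ M * (‖a‖ₑ * ‖b‖ₑ))
    (h : ∀ (κ : Type u) (e f : κ → H), Bessel e → Bessel f →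
      lpENorm p (fun k => ‖⟪f k, Z (e k)⟫_ℂ‖ₑ) ≤ M) :
    (p ≠ ∞ → IsCompactOperator Z) ∧ schattenENorm p Z ≤ M := by
  have hc := fun ht => isCompactOperator_of_lpENorm_le hp ht hM h
  refine ⟨hc, ?_⟩
  by_cases ht : p = ∞
  · subst ht
    rw [schattenENorm, if_pos rfl]
    exact enorm_le_of_enorm_inner_le htop
  · obtain ⟨ι, x, y, hx, hy, htr⟩ := exists_posTrace_eq Z (hc ht)
    have := h ι x y hx hy
    rwa [lpENorm_of_ne_top ht, ← htr _ (one_le_toReal hp ht), ← if_neg (c := p = ∞) ht (t := ‖Z‖ₑ)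
      (e := posTrace (CFC.abs Z ^ p.toReal) ^ (1 / p.toReal))] at this

end Compactness

/-! ### Functionals on O_{C,q} and their representing operators -/

section Represents

universe u
variable {H : Type u} [NormedAddCommGroup H] [InnerProductSpace ℂ H] [CompleteSpace H]
  (C : Conjugation H) {q : ℝ≥0∞} [hq : Fact (1 ≤ q)]

theorem SkewSchatten.enorm_def (X : SkewSchatten C q) : ‖X‖ₑ = schattenENorm q X.toOp := by
  rw [← ofReal_norm, SkewSchatten.norm_def, ENNReal.ofReal_toReal X.toOp_isSchatten.2.ne]

/-- The projection of the Schatten class onto `O_{C,q}`. -/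
noncomputable def toSkewSchatten : schattenSubmodule H q →ₗ[ℂ] SkewSchatten C q where
  toFun X := ⟨skewPart C X, skewPart_mem C X, (IsSchatten.skewPart C hq.out X.2).1⟩
  map_add' X Y := SkewSchatten.toOp_injective (map_add (skewPart C) (X : H →L[ℂ] H) Y)
  map_smul' c X := SkewSchatten.toOp_injective (map_smul (skewPart C) c (X : H →L[ℂ] H))

theorem toOp_toSkewSchatten (X : schattenSubmodule H q) :
    (toSkewSchatten C X).toOp = skewPart C X := rfl

theorem enorm_toSkewSchatten_le (X : schattenSubmodule H q) :
    ‖toSkewSchatten C X‖ₑ ≤ schattenENorm q (X : H →L[ℂ] H) := by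
  rw [SkewSchatten.enorm_def]
  exact (IsSchatten.skewPart C hq.out X.2).2

theorem enorm_apply_toSkewSchatten_le (f : StrongDual ℂ (SkewSchatten C q))
    (X : schattenSubmodule H q) :
    ‖f (toSkewSchatten C X)‖ₑ ≤ ‖f‖ₑ * schattenENorm q (X : H →L[ℂ] H) :=
  (f.le_opENorm _).trans (mul_le_mul_right (enorm_toSkewSchatten_le C X) _)

theorem toSkewSchatten_toOp (X : SkewSchatten C q) :
    toSkewSchatten C ⟨X.toOp, X.toOp_isSchatten⟩ = X :=
  SkewSchatten.toOp_injective (skewPart_eq_self C X.toOp_mem)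

/-- After normalization u and v are one-element Bessel systems, with the single coefficient ‖u‖ ‖v‖.
-/
theorem schattenENorm_rankOne_le (hq : 1 ≤ q) (u v : H) :
    schattenENorm q (rankOne ℂ u v) ≤ ‖u‖ₑ * ‖v‖ₑ := by
  have hunit : ∀ w : H, ‖((‖w‖⁻¹ : ℝ) : ℂ) • w‖ ≤ 1 := fun w => by
    rw [norm_smul, Complex.norm_real, norm_inv, norm_norm]
    exact inv_mul_le_one
  have hw : ∀ w : H, (‖w‖ : ℂ) • ((‖w‖⁻¹ : ℝ) : ℂ) • w = w := fun w => by
    by_cases h : w = 0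
    · simp [h]
    · have : (‖w‖ : ℂ) ≠ 0 := by simpa using h
      rw [smul_smul, Complex.ofReal_inv, mul_inv_cancel₀ this, one_smul]
  refine (schattenENorm_le_lpENorm hq (isCompactOperator_rankOne u v) (Bessel.const (hunit u))
    (Bessel.const (hunit v)) (fun _ => ‖u‖ₑ * ‖v‖ₑ) fun a b => ?_).trans ?_
  · rw [tsum_fintype, Fintype.sum_unique, rankOne_apply, inner_smul_right, enorm_mul]
    conv_lhs => rw [← hw u, ← hw v]
    rw [inner_smul_left, inner_smul_right, enorm_mul, enorm_mul, Complex.conj_ofReal,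
      enorm_ofReal_complex (norm_nonneg _), enorm_ofReal_complex (norm_nonneg _), ofReal_norm,
      ofReal_norm, enorm_inner_symm a]
    exact le_of_eq (by ring)
  · by_cases ht : q = ∞
    · subst ht; simp [lpENorm_top]
    · have := one_le_toReal hq ht
      rw [lpENorm_of_ne_top ht, tsum_fintype, Fintype.sum_unique, ← ENNReal.rpow_mul,
        mul_one_div_cancel (by linarith), ENNReal.rpow_one]

theorem rankOne_mem_schattenSubmodule (u v : H) : rankOne ℂ u v ∈ schattenSubmodule H q :=
  ⟨isCompactOperator_rankOne u v, (schattenENorm_rankOne_le hq.out u v).trans_lt (by finiteness)⟩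

theorem diagOp_mem_schattenSubmodule {κ : Type*} (F : Finset κ) (c : κ → ℂ) (e f : κ → H) :
    diagOp F c e f ∈ schattenSubmodule H q :=
  Submodule.sum_mem _ fun _ _ => Submodule.smul_mem _ _ (rankOne_mem_schattenSubmodule _ _)

/-- The functional `f` on `O_{C,q}` is represented by the operator `Z` on projections of rank one
operators. -/
def Represents (f : StrongDual ℂ (SkewSchatten C q)) (Z : H →L[ℂ] H) : Prop :=
  ∀ u v, f (toSkewSchatten C ⟨rankOne ℂ u v, rankOne_mem_schattenSubmodule u v⟩) = ⟪v, Z u⟫_ℂ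

variable {C} {f : StrongDual ℂ (SkewSchatten C q)} {Z : H →L[ℂ] H}

theorem Represents.apply_diagOp (h : Represents C f Z) {κ : Type*} (F : Finset κ) (c : κ → ℂ)
    (e g : κ → H) :
    f (toSkewSchatten C ⟨diagOp F c e g, diagOp_mem_schattenSubmodule F c e g⟩) =
      ∑ k ∈ F, c k * ⟪g k, Z (e k)⟫_ℂ := by
  have h1 : (⟨diagOp F c e g, diagOp_mem_schattenSubmodule F c e g⟩ : schattenSubmodule H q) =
      ∑ k ∈ F, c k • ⟨rankOne ℂ (e k) (g k), rankOne_mem_schattenSubmodule _ _⟩ := by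
    ext1
    simp [diagOp]
  rw [h1, map_sum, map_sum]
  refine Finset.sum_congr rfl fun k _ => ?_
  rw [map_smul, map_smul, h, smul_eq_mul]

/-- The test operators ∑ γ k |e k⟩⟨g k| have Schatten q-norm at most the ℓ^q norm of γ, and f sends
them to ∑ γ k ⟪g k, Z (e k)⟫. The converse of Hölder's inequality concludes. -/
theorem Represents.lpENorm_le (h : Represents C f Z) {p : ℝ≥0∞} (hpq : p⁻¹ + q⁻¹ = 1)
    {κ : Type*} {e g : κ → H} (he : Bessel e) (hg : Bessel g) :
    lpENorm p (fun k => ‖⟪g k, Z (e k)⟫_ℂ‖ₑ) ≤ ‖f‖ₑ := by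
  classical
  refine lpENorm_le_of_forall_sum hpq (a := fun k => ‖⟪g k, Z (e k)⟫_ℂ‖₊) fun F c => ?_
  let z : κ → ℂ := fun k => ⟪g k, Z (e k)⟫_ℂ
  -- The conjugate phase of z k makes γ k * z k equal to c k ‖z k‖. Where z k = 0, division by zero
  -- gives γ k = 0, which is harmless.
  let γ : κ → ℂ := fun k => (c k : ℝ) * (starRingEnd ℂ (z k) / (‖z k‖ : ℝ))
  have hγz : ∀ k, γ k * z k = ((c k * ‖z k‖ : ℝ) : ℂ) := fun k => by
    by_cases hz : z k = 0
    · simp [hz]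
    · have hn : ((‖z k‖ : ℝ) : ℂ) ≠ 0 := by simpa using hz
      simp only [γ]
      rw [mul_assoc, div_mul_eq_mul_div, RCLike.conj_mul]
      push_cast
      congr 1
      field_simp
      rfl
  have hγ : ∀ k, ‖γ k‖ₑ ≤ c k := fun k => by
    have h1 : ‖starRingEnd ℂ (z k) / ((‖z k‖ : ℝ) : ℂ)‖ ≤ 1 := by
      rw [norm_div, RCLike.norm_conj, Complex.norm_real, norm_norm]
      exact div_self_le_one _
    have h2 : ‖γ k‖ ≤ c k := by
      simp only [γ]
      rw [norm_mul, Complex.norm_real, Real.norm_of_nonneg (c k).coe_nonneg]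
      exact mul_le_of_le_one_right (c k).coe_nonneg h1
    rw [← ofReal_norm, ← ENNReal.ofReal_coe_nnreal]
    exact ENNReal.ofReal_le_ofReal h2
  have h1 : ∑ k ∈ F, ((‖⟪g k, Z (e k)⟫_ℂ‖₊ : NNReal) : ℝ≥0∞) * c k =
      ‖f (toSkewSchatten C ⟨diagOp F γ e g, diagOp_mem_schattenSubmodule F γ e g⟩)‖ₑ := by
    rw [h.apply_diagOp]
    rw [Finset.sum_congr rfl fun k _ => hγz k, ← Complex.ofReal_sum,
      enorm_ofReal_complex (Finset.sum_nonneg fun k _ => by positivity),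
      ENNReal.ofReal_sum_of_nonneg fun k _ => by positivity]
    refine Finset.sum_congr rfl fun k _ => ?_
    rw [mul_comm, ENNReal.ofReal_mul (c k).coe_nonneg, ENNReal.ofReal_coe_nnreal, ofReal_norm]
    rfl
  rw [h1]
  refine (enorm_apply_toSkewSchatten_le C f _).trans ?_
  gcongr
  refine (schattenENorm_diagOp_le hq.out F γ he hg).trans (lpENorm_mono fun k => ?_)
  split_ifs
  · exact hγ k
  · exact le_rfl

theorem Represents.schattenENorm_le (h : Represents C f Z) {p : ℝ≥0∞} (hpq : p⁻¹ + q⁻¹ = 1) :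
    (p ≠ ∞ → IsCompactOperator Z) ∧ schattenENorm p Z ≤ ‖f‖ₑ := by
  refine schattenENorm_le_of_lpENorm_le (one_le_of_inv_add_inv hpq) enorm_ne_top (fun a b => ?_)
    fun κ e g he hg => h.lpENorm_le hpq he hg
  rw [← h b a, mul_comm ‖a‖ₑ]
  exact (enorm_apply_toSkewSchatten_le C f _).trans
    (mul_le_mul_right (schattenENorm_rankOne_le hq.out b a) _)

theorem transpose_rankOne (C : Conjugation H) (u v : H) :
    transpose C (rankOne ℂ u v) = rankOne ℂ (C.toFun v) (C.toFun u) := by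
  ext b
  refine ext_inner_left ℂ fun a => ?_
  rw [inner_transpose, rankOne_apply, rankOne_apply, inner_smul_right, inner_smul_right,
    C.inner_left b, C.inner_right _ a, mul_comm]

/-- The operators |C a⟩⟨C b| and |b⟩⟨a| are transposes of each other, so their skew parts are
opposite and f takes opposite values on them. -/
theorem Represents.mem_skew (h : Represents C f Z) : Z ∈ skew C := by
  rw [mem_skew_iff]
  intro a b
  rw [← h, ← h, ← map_neg]
  congr 1
  apply SkewSchatten.toOp_injective
  change skewPart C _ = -skewPart C _
  rw [skewPart_apply, skewPart_apply, transpose_rankOne, transpose_rankOne, C.involutive',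
    C.involutive', ← smul_neg, neg_sub]

/-- Every bounded functional on `O_{C,q}` is represented by an operator. -/
theorem exists_represents (f : StrongDual ℂ (SkewSchatten C q)) : ∃ Z, Represents C f Z := by
  let R : H → H → schattenSubmodule H q := fun u v =>
    ⟨rankOne ℂ u v, rankOne_mem_schattenSubmodule u v⟩
  let B : H →ₗ⋆[ℂ] H →ₗ[ℂ] ℂ := LinearMap.mk₂'ₛₗ (starRingEnd ℂ) (RingHom.id ℂ)
    (fun v u => f (toSkewSchatten C (R u v)))
    (fun v v' u => by
      rw [← map_add, ← map_add]; congr 2; ext1; simp [R])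
    (fun c v u => by
      rw [← map_smul, ← map_smul]; congr 2; ext1; simp [R])
    (fun v u u' => by
      rw [← map_add, ← map_add]; congr 2; ext1; simp [R])
    (fun c v u => by
      rw [RingHom.id_apply, ← map_smul, ← map_smul]; congr 2; ext1; simp [R])
  let B' : H →L⋆[ℂ] H →L[ℂ] ℂ := B.mkContinuous₂ ‖f‖ fun v u => by
    have h1 := (enorm_apply_toSkewSchatten_le C f (R u v)).trans
      (mul_le_mul_right (schattenENorm_rankOne_le hq.out u v) _)
    have h2 := ENNReal.toReal_mono (by finiteness) h1
    simp only [ENNReal.toReal_mul, toReal_enorm] at h2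
    change ‖f (toSkewSchatten C (R u v))‖ ≤ _
    linarith
  -- The operator of the form satisfies ⟪B♯ v, u⟫ = B v u; the adjoint moves it to the second slot.
  refine ⟨ContinuousLinearMap.adjoint (continuousLinearMapOfBilin B'), fun u v => ?_⟩
  rw [ContinuousLinearMap.adjoint_inner_right, continuousLinearMapOfBilin_apply]
  rfl

/-- A bounded functional on `O_{C,q}` is determined by the operator that represents it. -/
theorem Represents.unique {g : StrongDual ℂ (SkewSchatten C q)} (hf : Represents C f Z)
    (hg : Represents C g Z) : f = g := by
  ext X
  obtain ⟨ι, x, y, m, hy, hm, hXx, h0, hle⟩ :=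
    exists_schmidt_expansion X.toOp X.toOp_isSchatten.1
  have htail := tendsto_schattenENorm_sub_diagOp hq.out X.toOp_isSchatten x hy hm hXx h0
    (hle q hq.out)
  -- The truncations of X need not lie in O_C, but X is its own skew part, so f (X) is the limit of
  -- f on their skew parts. Those values are written in terms of Z alone.
  have key : ∀ {f : StrongDual ℂ (SkewSchatten C q)}, Represents C f Z →
      Tendsto (fun F : Finset ι => ∑ i ∈ F, (m i : ℂ) * ⟪x i, Z (y i)⟫_ℂ) atTop (𝓝 (f X)) := by
    intro f hf
    rw [tendsto_iff_edist_tendsto_0]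
    have h1 : Tendsto (fun F : Finset ι => ‖f‖ₑ *
        schattenENorm q (X.toOp - diagOp F (fun i => (m i : ℂ)) y x)) atTop (𝓝 0) := by
      have := ENNReal.Tendsto.const_mul (a := ‖f‖ₑ) htail (Or.inr enorm_ne_top)
      rwa [mul_zero] at this
    refine tendsto_of_tendsto_of_tendsto_of_le_of_le tendsto_const_nhds h1 (fun _ => zero_le)
      fun F => ?_
    simp only
    rw [edist_comm, edist_eq_enorm_sub, ← hf.apply_diagOp]
    conv_lhs => rw [← toSkewSchatten_toOp C X]
    rw [← map_sub, ← map_sub]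
    exact enorm_apply_toSkewSchatten_le C f _
  exact tendsto_nhds_unique (key hf) (key hg)

end Represents

/-! ### Trace duality and the intertwining relation -/

section TraceDuality

universe u
variable {H : Type u} [NormedAddCommGroup H] [InnerProductSpace ℂ H] [CompleteSpace H]
  {C : Conjugation H} {p q : ℝ≥0∞} [hq : Fact (1 ≤ q)]

theorem isSchatten_one_mul (hpq : p⁻¹ + q⁻¹ = 1) {X Z : H →L[ℂ] H} (hX : IsSchatten q X)
    (hZ : p ≠ ∞ → IsCompactOperator Z) (hZ' : schattenENorm p Z < ∞) : IsSchatten 1 (X * Z) :=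
  ⟨hX.1.comp_clm Z, (schattenENorm_one_mul_le hpq hX.1 hZ).trans_lt (ENNReal.mul_lt_top hX.2 hZ')⟩

/-- The functional `X ↦ tr (X Z)` on `O_{C,q}`. -/
noncomputable def traceFunctional (C : Conjugation H) (hpq : p⁻¹ + q⁻¹ = 1) (Z : H →L[ℂ] H)
    (hZ : p ≠ ∞ → IsCompactOperator Z) (hZ' : schattenENorm p Z < ∞) :
    StrongDual ℂ (SkewSchatten C q) :=
  LinearMap.mkContinuous
    { toFun := fun X => trace (X.toOp * Z)
      map_add' := fun X Y => by
        rw [SkewSchatten.toOp_add, add_mul]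
        exact ((hasTrace_trace (isSchatten_one_mul hpq X.toOp_isSchatten hZ hZ')).add
          (hasTrace_trace (isSchatten_one_mul hpq Y.toOp_isSchatten hZ hZ'))).trace_eq
      map_smul' := fun c X => by
        rw [SkewSchatten.toOp_smul, smul_mul_assoc]
        exact ((hasTrace_trace (isSchatten_one_mul hpq X.toOp_isSchatten hZ hZ')).smul c).trace_eq }
    (schattenENorm p Z).toReal fun X => by
      have h1 := (enorm_trace_le (X.toOp_isSchatten.1.comp_clm Z)).trans
        (schattenENorm_one_mul_le hpq X.toOp_isSchatten.1 hZ)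
      have h2 := ENNReal.toReal_mono (ENNReal.mul_lt_top X.toOp_isSchatten.2 hZ').ne h1
      rw [toReal_enorm, ENNReal.toReal_mul, mul_comm] at h2
      exact h2

theorem hasTrace_traceFunctional (hpq : p⁻¹ + q⁻¹ = 1) (Z : H →L[ℂ] H)
    (hZ : p ≠ ∞ → IsCompactOperator Z) (hZ' : schattenENorm p Z < ∞) (X : SkewSchatten C q) :
    HasTrace (X.toOp * Z) (traceFunctional C hpq Z hZ hZ' X) :=
  hasTrace_trace (isSchatten_one_mul hpq X.toOp_isSchatten hZ hZ')

theorem norm_traceFunctional_le (hpq : p⁻¹ + q⁻¹ = 1) (Z : H →L[ℂ] H)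
    (hZ : p ≠ ∞ → IsCompactOperator Z) (hZ' : schattenENorm p Z < ∞) :
    ‖traceFunctional C hpq Z hZ hZ'‖ ≤ (schattenENorm p Z).toReal :=
  LinearMap.mkContinuous_norm_le _ ENNReal.toReal_nonneg _

/-- The trace of P|u⟩⟨v| Z is half of ⟪v, Z u⟫ − ⟪C u, Z (C v)⟫, and the two terms contribute
equally because Z is in O_C. No factor is therefore lost. -/
theorem represents_traceFunctional (hpq : p⁻¹ + q⁻¹ = 1) {Z : H →L[ℂ] H} (hs : Z ∈ skew C)
    (hZ : p ≠ ∞ → IsCompactOperator Z) (hZ' : schattenENorm p Z < ∞) :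
    Represents C (traceFunctional C hpq Z hZ hZ') Z := fun u v => by
  refine HasTrace.trace_eq ?_
  rw [toOp_toSkewSchatten, skewPart_apply, transpose_rankOne, smul_mul_assoc, sub_mul]
  have h := ((hasTrace_rankOne_mul u v Z).sub
    (hasTrace_rankOne_mul (C.toFun v) (C.toFun u) Z)).smul 2⁻¹
  rw [(mem_skew_iff C).1 hs] at h
  convert! h using 1
  ring

theorem toOp_adP (T : skew C) (X : SkewSchatten C q) :
    (adP C T q X).toOp = T * X.toOp - X.toOp * T := rfl

/-- Trace duality for a model `E` of the space of operators of `O_C` with finite Schatten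
`p`-norm, which are required to be compact for `p < ∞` only. -/
theorem trace_duality {E : Type*} [NormedAddCommGroup E] [NormedSpace ℂ E]
    (hpq : p⁻¹ + q⁻¹ = 1) (j : E →ₗ[ℂ] (H →L[ℂ] H)) (hskew : ∀ Z, j Z ∈ skew C)
    (hcomp : ∀ Z, p ≠ ∞ → IsCompactOperator (j Z)) (hfin : ∀ Z, schattenENorm p (j Z) < ∞)
    (hnorm : ∀ Z, ‖Z‖ = (schattenENorm p (j Z)).toReal)
    (hsurj : ∀ A ∈ skew C, (p ≠ ∞ → IsCompactOperator A) → schattenENorm p A < ∞ → ∃ Z, j Z = A)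
    (T : skew C) (D : E →L[ℂ] E) (hD : ∀ Z, j (D Z) = T * j Z - j Z * T) :
    Similar D (-dualOp (adP C T q)) ∧
      ∃ ψ : E ≃ₗᵢ[ℂ] StrongDual ℂ (SkewSchatten C q),
        (∀ (Z : E) (X : SkewSchatten C q), HasTrace (X.toOp * j Z) (ψ Z X)) ∧
        ∀ Z, ψ (D Z) = (-dualOp (adP C T q)) (ψ Z) := by
  let φ : E → StrongDual ℂ (SkewSchatten C q) := fun Z =>
    traceFunctional C hpq (j Z) (hcomp Z) (hfin Z)
  have hφ : ∀ Z X, HasTrace (X.toOp * j Z) (φ Z X) := fun Z X =>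
    hasTrace_traceFunctional hpq (j Z) (hcomp Z) (hfin Z) X
  have hrep : ∀ Z, Represents C (φ Z) (j Z) := fun Z =>
    represents_traceFunctional hpq (hskew Z) (hcomp Z) (hfin Z)
  let Φ : E →ₗᵢ[ℂ] StrongDual ℂ (SkewSchatten C q) :=
    { toFun := φ
      map_add' := fun Z W => by
        ext X
        refine (hφ (Z + W) X).trace_eq.symm.trans ?_
        rw [map_add, mul_add]
        exact ((hφ Z X).add (hφ W X)).trace_eq
      map_smul' := fun c Z => by
        ext X
        refine (hφ (c • Z) X).trace_eq.symm.trans ?_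
        rw [map_smul, mul_smul_comm]
        exact ((hφ Z X).smul c).trace_eq
      norm_map' := fun Z => by
        -- The upper bound is Hölder's inequality for the trace; the lower one is the diagonal
        -- estimate for the operator representing the functional.
        refine le_antisymm ((norm_traceFunctional_le hpq _ (hcomp Z) (hfin Z)).trans (hnorm Z).ge) ?_
        have h1 := ENNReal.toReal_mono enorm_ne_top ((hrep Z).schattenENorm_le hpq).2
        rwa [toReal_enorm, ← hnorm] at h1 }
  have hsurjΦ : Function.Surjective Φ := fun f => by
    obtain ⟨A, hA⟩ := exists_represents f
    have h1 := hA.schattenENorm_le hpq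
    obtain ⟨Z, rfl⟩ := hsurj A hA.mem_skew h1.1 (h1.2.trans_lt enorm_lt_top)
    exact ⟨Z, (hrep Z).unique hA⟩
  let ψ := LinearIsometryEquiv.ofSurjective Φ hsurjΦ
  have hψ : ∀ Z, ψ (D Z) = (-dualOp (adP C T q)) (ψ Z) := fun Z => by
    ext X
    change φ (D Z) X = -(φ Z (adP C T q X))
    have hXZ := isSchatten_one_mul hpq X.toOp_isSchatten (hcomp Z) (hfin Z)
    have h1 := hφ Z (adP C T q X)
    rw [toOp_adP, sub_mul] at h1
    have h2 : HasTrace (X.toOp * j Z * (T : H →L[ℂ] H))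
        (trace ((T : H →L[ℂ] H) * (X.toOp * j Z))) := by
      rw [← trace_mul_comm hXZ]
      simpa using hasTrace_trace (hXZ.mul le_rfl 1 T)
    have h3 : HasTrace ((T : H →L[ℂ] H) * (X.toOp * j Z))
        (trace ((T : H →L[ℂ] H) * (X.toOp * j Z))) := by
      simpa using hasTrace_trace (hXZ.mul le_rfl T 1)
    -- X T Z is T X Z minus (T X − X T) Z, both of known trace. Subtracting the trace of X Z T,
    -- which equals that of T X Z by cyclicity, leaves the required sign.
    have h4 : HasTrace (X.toOp * (T : H →L[ℂ] H) * j Z)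
        (trace ((T : H →L[ℂ] H) * (X.toOp * j Z)) - φ Z (adP C T q X)) := by
      convert! h3.sub h1 using 1
      rw [mul_assoc (T : H →L[ℂ] H), sub_sub_cancel]
    have h5 := h4.sub h2
    rw [sub_sub_cancel_left] at h5
    rw [← (hφ (D Z) X).trace_eq, hD, mul_sub, ← mul_assoc, ← mul_assoc]
    exact h5.trace_eq
  refine ⟨⟨ψ.toContinuousLinearEquiv, ?_⟩, ψ, hφ, hψ⟩
  ext1 Z
  exact hψ Z

end TraceDuality

/-! ### The three dualities -/

theorem trace_duality_skewSchatten {H : Type*} [NormedAddCommGroup H]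
    [InnerProductSpace ℂ H] [CompleteSpace H] (C : Conjugation H) (T : skew C) (p q : ℝ≥0∞)
    [hp : Fact (1 ≤ p)] [hq : Fact (1 ≤ q)] (ht : p ≠ ∞) (hpq : p⁻¹ + q⁻¹ = 1) :
    Similar (adP C T p) (-dualOp (adP C T q)) ∧
      ∃ ψ : SkewSchatten C p ≃ₗᵢ[ℂ] StrongDual ℂ (SkewSchatten C q),
        (∀ (Z : SkewSchatten C p) (X : SkewSchatten C q), HasTrace (X.toOp * Z.toOp) (ψ Z X)) ∧
        ∀ Z, ψ (adP C T p Z) = (-dualOp (adP C T q)) (ψ Z) :=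
  trace_duality hpq
    { toFun := SkewSchatten.toOp
      map_add' := SkewSchatten.toOp_add
      map_smul' := SkewSchatten.toOp_smul }
    (fun Z => Z.toOp_mem) (fun Z _ => Z.toOp_isSchatten.1) (fun Z => Z.toOp_isSchatten.2)
    SkewSchatten.norm_def (fun A hA hc hf => ⟨⟨A, hA, hc ht, hf⟩, rfl⟩) T _ (toOp_adP T)

end SkewLie

theorem proposition3p17 {H : Type*} [NormedAddCommGroup H] [InnerProductSpace ℂ H]
    [CompleteSpace H] [TopologicalSpace.SeparableSpace H]
    (C : SkewLie.Conjugation H) (T : SkewLie.skew C) :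
    -- (i)
    (SkewLie.Similar (SkewLie.ad C T) (-SkewLie.dualOp (SkewLie.adP C T 1)) ∧
      ∃ ψ : SkewLie.skew C ≃ₗᵢ[ℂ] StrongDual ℂ (SkewLie.SkewSchatten C 1),
        (∀ (Z : SkewLie.skew C) (X : SkewLie.SkewSchatten C 1),
          SkewLie.HasTrace (X.toOp * (Z : H →L[ℂ] H)) (ψ Z X)) ∧
        ∀ Z, ψ (SkewLie.ad C T Z) = (-SkewLie.dualOp (SkewLie.adP C T 1)) (ψ Z)) ∧
    -- (ii)
    (SkewLie.Similar (SkewLie.adP C T 1) (-SkewLie.dualOp (SkewLie.adP C T ∞)) ∧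
      ∃ ψ : SkewLie.SkewSchatten C 1 ≃ₗᵢ[ℂ] StrongDual ℂ (SkewLie.SkewSchatten C ∞),
        (∀ (Z : SkewLie.SkewSchatten C 1) (X : SkewLie.SkewSchatten C ∞),
          SkewLie.HasTrace (X.toOp * Z.toOp) (ψ Z X)) ∧
        ∀ Z, ψ (SkewLie.adP C T 1 Z) = (-SkewLie.dualOp (SkewLie.adP C T ∞)) (ψ Z)) ∧
    -- (iii)
    (∀ (p q : ℝ≥0∞) [Fact (1 ≤ p)] [Fact (1 ≤ q)],
      1 < p → p < ∞ → 1 < q → q < ∞ → 1 / p + 1 / q = 1 →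
      SkewLie.Similar (SkewLie.adP C T p) (-SkewLie.dualOp (SkewLie.adP C T q)) ∧
      ∃ ψ : SkewLie.SkewSchatten C p ≃ₗᵢ[ℂ] StrongDual ℂ (SkewLie.SkewSchatten C q),
        (∀ (Z : SkewLie.SkewSchatten C p) (X : SkewLie.SkewSchatten C q),
          SkewLie.HasTrace (X.toOp * Z.toOp) (ψ Z X)) ∧
        ∀ Z, ψ (SkewLie.adP C T p Z) = (-SkewLie.dualOp (SkewLie.adP C T q)) (ψ Z)) := by
  -- Case (i) takes p = ∞, q = 1 with O_C itself as the model: compactness is then not required,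
  -- whereas `SkewSchatten C ∞` contains compact operators only.
  refine ⟨SkewLie.trace_duality (p := ∞) (by simp) (SkewLie.skew C).subtype (fun Z => Z.2)
    (fun _ h => absurd rfl h) (fun Z => ?_) (fun Z => ?_) (fun A hA _ _ => ⟨⟨A, hA⟩, rfl⟩) T _
    (fun _ => rfl), SkewLie.trace_duality_skewSchatten C T 1 ∞ ENNReal.one_ne_top (by simp),
    fun p q _ _ _ hp _ _ hpq =>
      SkewLie.trace_duality_skewSchatten C T p q hp.ne (by simpa using hpq)⟩
  · rw [SkewLie.schattenENorm, if_pos rfl]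
    exact enorm_lt_top
  · rw [SkewLie.schattenENorm, if_pos rfl, toReal_enorm]
    rfl
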